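/- **Setting.** Let $H$ be a Hermitian operator on a finite-dimensional complex Hilbert space with an orthonormal basis of eigenvectors $\psi_0,\dots,\psi_{M}$ and eigenvalues $\lambda_0,\dots,\lambda_{M}\in[-\pi,\pi]$ ($\lambda_0$ is the target, e.g. the ground-state energy). Let $\psi$ be a unit vector, $p_m=|\langle\psi_m,\psi\rangle|^2$, and $p_0>0$. Let $I\subset I'\subset[-\pi,\pi]$ be intervals with $\lambda_0\in I$ and $$D=\operatorname{dist}(\mathbb R\setminus I',I)>0,\qquad p_r=p_r(I,I')=\frac{p_0\,\mathbf 1_{\lambda_0\in I}}{\sum_{\lambda_k\in I'}p_k}.$$ *Circuit.* The Hadamard test with time $t$ and $W\in\{\mathrm{Id},S^\dagger\}$ starts from $|0\rangle\otimes\psi$, applies a Hadamard gate to the ancilla, the controlled evolution $e^{-itH}$, the gate $W$ and a second Hadamard gate to the ancilla, and measures the ancilla; outcome $0$ is recorded as $+1$, outcome $1$ as $-1$. *Filter.* A filter of degree $d$ and error $q$ is $F_q(x)=\sum_{l=-d}^{d}\hat F_l e^{-ilx}$ with $|F_q-1|\le q$ on $I$, $|F_q|\le q$ on $[-\pi,\pi]\setminus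 I'$ and $|F_q|\le 1+q$ everywhere. Put $\mathcal F=\sum_l|\hat F_l|$ and $\hat F_l=|\hat F_l|e^{i\phi_l}$. *Algorithm.* Given $\epsilon,\delta,N,N_s$, put $J=\lceil\log_2(1/\epsilon)\rceil+1$ and $\tau_j=2^{j-1-\lceil\log_2(1/\epsilon)\rceil}\frac{\delta}{N\epsilon}$ for $1\le j\le J$. For all $j\le J$, $0\le n<N$, $1\le k\le N_s$, independently: draw $l\in\{-d,\dots,d\}$ with probability $|\hat F_l|/\mathcal F$, run the circuit at time $l+n\tau_j$ once with $W=\mathrm{Id}$ (result $X$) and once with $W=S^\dagger$ (result $Y$), and set $Z_{k,n}=(X+iY)e^{i\phi_l}\mathcal F$. Let $Z_n=\frac1{N_s}\sum_kZ_{k,n}$ at level $j$, and let $(r_j^*,\theta_j^*)$ be a minimizer of $\frac1N\sum_{n=0}^{N-1}|Z_n-re^{-i\theta n\tau_j}|^2$ over $r\in\mathbb C$ and $\theta$ in the search interval, which is $[-\pi,\pi]$ for $j=1$ and $[\theta_{j-1}^*-\frac{\pi}{2\tau_{j-1}},\theta_{j-1}^*+\frac{\pi}{2\tau_{j-1}}]$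 for $j>1$. The output is $\theta^*=\theta^*_J$. The maximal evolution time is $T_{\max}=d+N\tau_J$. The total evolution time $T_{\rm total}=\sum_{j=1}^J\sum_{n=0}^{N-1}2N_s(d+n\tau_j)$ charges to each circuit its largest possible evolution time. Write $\operatorname{polylog}_k(x)=\log(e+x)^k$ and $$X=p_0^{-2}\,\delta^{-(2+\zeta)}\operatorname{polylog}_{k_2}\!\big(\log(\zeta^{-1})\log(\epsilon^{-1})D^{-1}\eta^{-1}p_0^{-1}\big).$$ **Theorem.** There are absolute constants $c_1,\delta_0,\kappa>0$ and $k_1,k_2\in\mathbb N$ such that for every $0<\kappa'\le\kappa$ there is $A_0\ge1$ such that for every $A\ge A_0$ and $0<\zeta<1$ there is $C>0$ with the following property. In the setting above let $0<\epsilon<1/2$, $0<\eta<1$, $\delta>0$, $$c_1\sqrt{1-p_r}\le\delta\le\delta_0,\qquad \kappa'p_0\delta^2\le q\le\kappa p_0\delta^2$$ (so $\delta=\Theta(\sqrt{1-p_r})$ is allowed as soon as $p_r$ is close enough to $1$, and $q=\Theta(p_0\delta^2)$). Then: 1. There is a filter $F_q$ of degree $d$ and error $q$ with $$A^{-1}D^{-1}\operatorname{polylog}_{k_1}(p_0^{-1}\delta^{-1})\le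 d\le A\,D^{-1}\operatorname{polylog}_{k_1}(p_0^{-1}\delta^{-1}),\qquad \mathcal F\le A\log(e+d).\tag{$*$}$$ 2. For every filter of degree $d$ and error $q$ with $(*)$ and all $N\ge2$, $N_s$ with $NN_s\ge C\,X$: - with probability at least $1-\eta$, the output satisfies $|\theta^*-\lambda_0|<\epsilon$ (whatever minimizers are chosen); - $T_{\max}=d+\delta/\epsilon$, and no circuit has a longer evolution time; - the evolution times of all circuits always add up to at most $T_{\rm total}$; and $T_{\rm total}\ge\frac C2X\,(Jd+\delta/\epsilon)$, while $T_{\rm total}\le2B\,X\,(Jd+\delta/\epsilon)$ whenever $NN_s\le B\,X$. In particular $T_{\rm total}=\widetilde\Theta\big(p_0^{-2}\delta^{-(2+\zeta)}(d+\delta/\epsilon)\big)$ if $NN_s=\Theta(X)$, since $J=O(\log(1/\epsilon))$. -/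

import Mathlib

open MeasureTheory

noncomputable section

namespace QCELS

/-! ### Eigenpairs, overlaps, intervals -/

section Spectral

variable {E : Type*} [NormedAddCommGroup E] [InnerProductSpace ℂ E]

/-- The vectors `v 0, …, v M` form an orthonormal basis of eigenvectors of `H`, with real
eigenvalues `lam 0, …, lam M`. (In particular `H` is a Hermitian operator on a
finite-dimensional space.) -/
def IsEigensystem {M : ℕ} (H : E →L[ℂ] E) (v : OrthonormalBasis (Fin (M + 1)) ℂ E)
    (lam : Fin (M + 1) → ℝ) : Prop :=
  ∀ m, H (v m) = (lam m : ℂ) • v m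

/-- The overlap `p_m = |⟨ψ_m, ψ⟩|²`. -/
def overlap {M : ℕ} (v : OrthonormalBasis (Fin (M + 1)) ℂ E) (ψ : E) (m : Fin (M + 1)) : ℝ :=
  ‖inner ℂ (v m) ψ‖ ^ 2

/-- The relative overlap `p_r(I, I') = p_0 1_{λ_0 ∈ I} / ∑_{λ_k ∈ I'} p_k`. -/
def relOverlap {M : ℕ} (v : OrthonormalBasis (Fin (M + 1)) ℂ E) (lam : Fin (M + 1) → ℝ) (ψ : E)
    (I I' : Set ℝ) : ℝ :=
  I.indicator (fun _ => overlap v ψ 0) (lam 0) /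
    ∑ k, I'.indicator (fun _ => overlap v ψ k) (lam k)

/-- `D = dist((I')ᶜ, I) = inf {|x₁ - x₂| : x₁ ∉ I', x₂ ∈ I}`, the complement being taken in `ℝ`. -/
def gapDist (I I' : Set ℝ) : ℝ :=
  sInf {s : ℝ | ∃ x₁ ∉ I', ∃ x₂ ∈ I, s = |x₁ - x₂|}

/-! ### The Hadamard test circuit -/

/-- The Hamiltonian evolution `exp(-i t H)`. -/
def evolution (H : E →L[ℂ] E) (t : ℝ) : E →L[ℂ] E :=
  NormedSpace.exp ((-(Complex.I * (t : ℂ))) • H)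

/-- Hadamard gate on the ancilla; a state `|0⟩ ⊗ a + |1⟩ ⊗ b` of ancilla and system is the
pair `(a, b)`. -/
def hadamardGate (s : E × E) : E × E :=
  ((((Real.sqrt 2)⁻¹ : ℝ) : ℂ) • (s.1 + s.2), (((Real.sqrt 2)⁻¹ : ℝ) : ℂ) • (s.1 - s.2))

/-- The operator `U` on the system, controlled by the ancilla. -/
def controlled (U : E →L[ℂ] E) (s : E × E) : E × E := (s.1, U s.2)

/-- The gate `diag(1, w)` on the ancilla: the identity for `w = 1`, and `S†` for `w = -i`. -/
def ancillaPhase (w : ℂ) (s : E × E) : E × E := (s.1, w • s.2)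

/-- State of ancilla and system before the measurement, with `W = diag(1, w)`. -/
def circuitState (H : E →L[ℂ] E) (ψ : E) (w : ℂ) (t : ℝ) : E × E :=
  hadamardGate (ancillaPhase w (controlled (evolution H t) (hadamardGate (ψ, 0))))

/-- Law of the measurement outcome (`0` or `1`) of the ancilla. -/
def circuitLaw (H : E →L[ℂ] E) (ψ : E) (w : ℂ) (t : ℝ) : Measure (Fin 2) :=
  ENNReal.ofReal (‖(circuitState H ψ w t).1‖ ^ 2) • Measure.dirac 0 +
    ENNReal.ofReal (‖(circuitState H ψ w t).2‖ ^ 2) • Measure.dirac 1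

end Spectral

/-- The value `1` for the outcome `0`, and `-1` for the outcome `1`. -/
def outcomeSign (o : Fin 2) : ℝ := if o = 0 then 1 else -1

/-! ### Fourier filters -/

/-- The frequencies `-d, …, d`. -/
abbrev Freq (d : ℕ) : Type := {l : ℤ // l ∈ Finset.Icc (-(d : ℤ)) (d : ℤ)}

/-- The trigonometric polynomial `F_q(x) = ∑_{|l| ≤ d} F̂_l exp(-i l x)`. The sign in the exponent is
the one for which `F_q(H)` is the combination of the evolutions `exp(-i l H)` with weights `F̂_l`. -/
def filterEval {d : ℕ} (F : Freq d → ℂ) (x : ℝ) : ℂ :=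
  ∑ l, F l * Complex.exp (-(Complex.I * ((l : ℤ) : ℂ) * (x : ℂ)))

/-- `∑_{|l| ≤ d} |F̂_l|`. -/
def filterNorm {d : ℕ} (F : Freq d → ℂ) : ℝ := ∑ l, ‖F l‖

/-- `F` separates `I` from `[-π, π] \ I'` with error `q`, and it is bounded by `1 + q`. -/
def IsFilter {d : ℕ} (F : Freq d → ℂ) (q : ℝ) (I I' : Set ℝ) : Prop :=
  (∀ x ∈ I, ‖filterEval F x - 1‖ ≤ q) ∧
  (∀ x ∈ Set.Icc (-Real.pi) Real.pi \ I', ‖filterEval F x‖ ≤ q) ∧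
  (∀ x, ‖filterEval F x‖ ≤ 1 + q)

/-- The polylogarithmic factor `log(e + x)^k`. -/
def polylog (k : ℕ) (x : ℝ) : ℝ := Real.log (Real.exp 1 + x) ^ k

/-- Size bounds for a filter, with implied constant `A`:
`d = Θ(D⁻¹ polylog(p₀⁻¹ δ⁻¹))` and `∑ |F̂_l| = O(log d)`. -/
def FilterSize {d : ℕ} (F : Freq d → ℂ) (A : ℝ) (k : ℕ) (D p₀ δ : ℝ) : Prop :=
  A⁻¹ * (D⁻¹ * polylog k (p₀⁻¹ * δ⁻¹)) ≤ (d : ℝ) ∧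
  (d : ℝ) ≤ A * (D⁻¹ * polylog k (p₀⁻¹ * δ⁻¹)) ∧
  filterNorm F ≤ A * Real.log (Real.exp 1 + (d : ℝ))

/-! ### Time steps -/

/-- The number of levels `J = ⌈log₂(1/ε)⌉ + 1`. -/
def numLevels (ε : ℝ) : ℕ := ⌈Real.logb 2 (1 / ε)⌉₊ + 1

/-- The time steps `2^{j-1-⌈log₂(1/ε)⌉} δ/(N ε)`, `1 ≤ j ≤ J`. Levels are counted from `0` here:
`timeStep ε δ N i` is the step of level `j = i + 1`. -/
def timeStep (ε δ : ℝ) (N : ℕ) (i : ℕ) : ℝ :=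
  (2 : ℝ) ^ ((i : ℤ) - (⌈Real.logb 2 (1 / ε)⌉₊ : ℤ)) * (δ / (N * ε))

/-! ### The filtered data set -/

/-- One run of the data generator: the random frequency and the two measurement outcomes
(for `W = I` and `W = S†`). -/
abbrev Sample (d : ℕ) : Type := Freq d × Fin 2 × Fin 2

/-- The outcomes of all runs, indexed by level, data point `n` and repetition `k`. -/
abbrev Outcomes (d J N Ns : ℕ) : Type := Fin J × Fin N × Fin Ns → Sample d

section Data

variable {E : Type*} [NormedAddCommGroup E] [InnerProductSpace ℂ E]

/-- Law of one run at base time `t = n τ`: the frequency `l` is drawn with probability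
`β_l = |F̂_l| / ∑ |F̂|`, then the circuit is run at time `l + t` with `W = I` and, independently,
with `W = S†`. -/
def sampleLaw (H : E →L[ℂ] E) (ψ : E) {d : ℕ} (F : Freq d → ℂ) (t : ℝ) : Measure (Sample d) :=
  ∑ l : Freq d, ENNReal.ofReal (‖F l‖ / filterNorm F) •
    (Measure.dirac l).prod
      ((circuitLaw H ψ 1 (((l : ℤ) : ℝ) + t)).prod
        (circuitLaw H ψ (-Complex.I) (((l : ℤ) : ℝ) + t)))

/-- Law of the outcomes of all runs; different runs are independent. -/
def outcomesLaw (H : E →L[ℂ] E) (ψ : E) {d : ℕ} (F : Freq d → ℂ) (J N Ns : ℕ) (τ : ℕ → ℝ) :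
    Measure (Outcomes d J N Ns) :=
  Measure.pi fun a => sampleLaw H ψ F (((a.2.1 : ℕ) : ℝ) * τ a.1)

end Data

/-- `Z_{k,n,q} = (X + i Y) exp(i φ_l) ∑ |F̂|`, where `φ_l` is the argument of `F̂_l`. -/
def sampleValue {d : ℕ} (F : Freq d → ℂ) (s : Sample d) : ℂ :=
  ((outcomeSign s.2.1 : ℂ) + Complex.I * (outcomeSign s.2.2 : ℂ)) *
    Complex.exp (Complex.I * ((F s.1).arg : ℂ)) * (filterNorm F : ℂ)

/-- `Z_{n,q} = N_s⁻¹ ∑_k Z_{k,n,q}` at level `i`. -/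
def filteredData {d J N Ns : ℕ} (F : Freq d → ℂ) (ω : Outcomes d J N Ns) (i : Fin J) (n : Fin N) :
    ℂ :=
  (Ns : ℂ)⁻¹ * ∑ k, sampleValue F (ω (i, n, k))

/-! ### Multi-level least squares -/

/-- The loss `L(r, θ) = N⁻¹ ∑_n |Z_n - r exp(-i θ n τ)|²`. -/
def loss {N : ℕ} (Z : Fin N → ℂ) (τ : ℝ) (r : ℂ) (θ : ℝ) : ℝ :=
  (N : ℝ)⁻¹ * ∑ n : Fin N, ‖Z n - r * Complex.exp (-(Complex.I * θ * ((n : ℕ) : ℂ) * τ))‖ ^ 2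

/-- Search interval `[λ_min, λ_max]` at each level: `[-π, π]` at the first one, and then
`[θ - π/(2τ), θ + π/(2τ)]` with the estimate `θ` and the time step `τ` of the previous level. -/
def searchInterval (τ θ : ℕ → ℝ) : ℕ → Set ℝ
  | 0 => Set.Icc (-Real.pi) Real.pi
  | i + 1 => Set.Icc (θ i - Real.pi / (2 * τ i)) (θ i + Real.pi / (2 * τ i))

/-- `(r i, θ i)`, `i < J`, are the successive minimizers of a run of the multi-level algorithm on the
data `Z` (any choice of minimizers is allowed). -/
def IsRun {J N : ℕ} (Z : Fin J → Fin N → ℂ) (τ : ℕ → ℝ) (r : ℕ → ℂ) (θ : ℕ → ℝ) : Prop :=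
  ∀ i : Fin J, θ i ∈ searchInterval τ θ i ∧
    ∀ r' : ℂ, ∀ θ' ∈ searchInterval τ θ i, loss (Z i) (τ i) (r i) (θ i) ≤ loss (Z i) (τ i) r' θ'

/-- The event that the algorithm estimates `lam₀` to precision `ε`: whatever minimizers are chosen,
the output (the estimate of the last level) is at distance less than `ε` from `lam₀`. -/
def successEvent {d J N Ns : ℕ} (F : Freq d → ℂ) (τ : ℕ → ℝ) (lam₀ ε : ℝ) :
    Set (Outcomes d J N Ns) :=
  {ω | ∀ r θ, IsRun (filteredData F ω) τ r θ → |θ (J - 1) - lam₀| < ε}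

/-! ### Evolution times -/

/-- Evolution time `|l + n τ_j|` of the two circuits of one run. -/
def circuitTime {d J N Ns : ℕ} (τ : ℕ → ℝ) (ω : Outcomes d J N Ns)
    (a : Fin J × Fin N × Fin Ns) : ℝ :=
  |(((ω a).1 : ℤ) : ℝ) + ((a.2.1 : ℕ) : ℝ) * τ a.1|

/-- Maximal evolution time `d + N τ_J`. -/
def maxTime (d J N : ℕ) (τ : ℕ → ℝ) : ℝ := d + N * τ (J - 1)

/-- Total evolution time: every level `j` and `n < N` needs `2 N_s` circuits (`W = I` and `W = S†`),
each of evolution time at most `d + n τ_j`. -/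
def totalTime (d J N Ns : ℕ) (τ : ℕ → ℝ) : ℝ :=
  ∑ i ∈ Finset.range J, ∑ n ∈ Finset.range N, 2 * (Ns : ℝ) * (d + n * τ i)

/-- `p₀⁻² δ^{-(2+ζ)} polylog(log(ζ⁻¹) log(ε⁻¹) D⁻¹ η⁻¹ p₀⁻¹)`. -/
def sampleBound (k : ℕ) (ζ ε η p₀ δ D : ℝ) : ℝ :=
  (p₀ ^ 2)⁻¹ * δ ^ (-(2 + ζ)) *
    polylog k (Real.log ζ⁻¹ * Real.log ε⁻¹ * D⁻¹ * η⁻¹ * p₀⁻¹)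

end QCELS

end

/-!
The sample `(X + iY) exp(iφ_l) 𝓕` of a run at base time `t` has mean
`∑ m, p_m F_q(λ_m) exp(-i t λ_m)`, which the filter turns into `p₀ F_q(λ₀) exp(-i t λ₀)` up to a
bias `O(p₀ (1 - p_r) + q) = O(p₀ δ²)`. After minimization over `r`, least squares at step `τ`
amounts to maximizing the correlation `|N⁻¹ ∑ n, Z_n exp(i n θ τ)|`. For the signal alone this
drops by a multiple of `p₀ min(1, u)²` at distance `u = N τ |θ - λ₀|` from the maximum, while
noise of size `O(p₀ δ)` shifts it by only `O(p₀ δ u)`. Hence `u < δ`, which keeps `λ₀` inside the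
next search interval, where `τ` is twice as large, and amounts to the error `ε` at the last level.

By Hoeffding's inequality and a union bound the noise has this size on a grid of phases, for all
initial sums `n < m ≤ N`; summation by parts extends the bound to all phases. The logarithms lost
in the union bound and in `𝓕² = O(log² d)` are absorbed by `δ^{-ζ}` and by the polylogarithm in
the lower bound for `N N_s`.

A filter is the convolution of the indicator of an enlargement of `I` with a Jackson kernel, a
nonnegative trigonometric polynomial concentrated near `0`. Like those of an indicator, its
coefficients are `O(1/|l|)`, which is why `𝓕` is only logarithmic in `d`.
-/

noncomputable section

namespace QCELS

open scoped Real ComplexConjugate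

/-- The unit complex number `exp(i x)`. -/
def phase (x : ℝ) : ℂ := Complex.exp (Complex.I * x)

@[simp] lemma phase_zero : phase 0 = 1 := by simp [phase]

lemma phase_add (x y : ℝ) : phase (x + y) = phase x * phase y := by
  simp [phase, mul_add, Complex.exp_add]

@[simp] lemma norm_phase (x : ℝ) : ‖phase x‖ = 1 := Complex.norm_exp_I_mul_ofReal x

lemma conj_phase (x : ℝ) : conj (phase x) = phase (-x) := by
  simp [phase, ← Complex.exp_conj]

@[fun_prop] lemma continuous_phase : Continuous phase := by unfold phase; fun_prop

lemma norm_phase_sub_one (x : ℝ) : ‖phase x - 1‖ = 2 * |Real.sin (x / 2)| := by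
  rw [phase, Complex.norm_exp_I_mul_ofReal_sub_one, Real.norm_eq_abs, abs_mul, abs_two]

lemma norm_phase_sub_one_le (x : ℝ) : ‖phase x - 1‖ ≤ |x| :=
  Real.norm_exp_I_mul_ofReal_sub_one_le

lemma norm_one_add_phase (x : ℝ) : ‖1 + phase x‖ = 2 * |Real.cos (x / 2)| := by
  have hshift : phase (x + π) = -phase x := by
    rw [phase_add, phase, phase, mul_comm Complex.I (π : ℂ), Complex.exp_pi_mul_I, mul_neg_one]
  have := norm_phase_sub_one (x + π)
  rwa [hshift, add_div, Real.sin_add_pi_div_two, ← neg_add', norm_neg, add_comm] at this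

lemma sum_range_add_phase (h m : ℕ) (x : ℝ) :
    ∑ n ∈ Finset.range (h + m), phase (n * x) =
      ∑ n ∈ Finset.range h, phase (n * x)
        + phase (h * x) * ∑ n ∈ Finset.range m, phase (n * x) := by
  simp only [Finset.sum_range_add, Finset.mul_sum, Nat.cast_add, add_mul, phase_add]

lemma norm_sum_range_phase_le (N : ℕ) (x : ℝ) : ‖∑ n ∈ Finset.range N, phase (n * x)‖ ≤ N := by
  refine (norm_sum_le _ _).trans ?_
  simp only [norm_phase, Finset.sum_const, Finset.card_range, nsmul_eq_mul, mul_one, le_refl]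

/-- The normalized Dirichlet kernel `N⁻¹ ∑_{n < N} exp(i n x)`. It is the response of the fit to a
pure oscillation, and a power of it is the kernel from which the filters are built. -/
def dirichletAvg (N : ℕ) (x : ℝ) : ℂ := (N : ℂ)⁻¹ * ∑ n ∈ Finset.range N, phase (n * x)

lemma dirichletAvg_zero {N : ℕ} (hN : 0 < N) : dirichletAvg N 0 = 1 := by
  simp [dirichletAvg, hN.ne']

lemma natCast_mul_norm_dirichletAvg {N : ℕ} (hN : 0 < N) (x : ℝ) :
    N * ‖dirichletAvg N x‖ = ‖∑ n ∈ Finset.range N, phase (n * x)‖ := by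
  have hN' : (N : ℝ) ≠ 0 := by positivity
  rw [dirichletAvg, norm_mul, norm_inv, Complex.norm_natCast, mul_inv_cancel_left₀ hN']

lemma norm_dirichletAvg_le_one (N : ℕ) (x : ℝ) : ‖dirichletAvg N x‖ ≤ 1 := by
  rcases Nat.eq_zero_or_pos N with rfl | hN
  · simp [dirichletAvg]
  · refine le_of_mul_le_mul_left ?_ (Nat.cast_pos (α := ℝ).2 hN)
    rw [natCast_mul_norm_dirichletAvg hN, mul_one]
    exact norm_sum_range_phase_le N x

lemma norm_one_sub_dirichletAvg_le {N : ℕ} (hN : 0 < N) (x : ℝ) :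
    ‖1 - dirichletAvg N x‖ ≤ N * |x| := by
  have hN' : (N : ℂ) ≠ 0 := by exact_mod_cast hN.ne'
  have hsum : 1 - dirichletAvg N x = (N : ℂ)⁻¹ * ∑ n ∈ Finset.range N, (1 - phase (n * x)) := by
    rw [dirichletAvg, Finset.sum_sub_distrib, mul_sub]
    simp [hN']
  rw [hsum, norm_mul, norm_inv, Complex.norm_natCast, inv_mul_le_iff₀ (by positivity)]
  calc ‖∑ n ∈ Finset.range N, (1 - phase (n * x))‖
      ≤ ∑ _n ∈ Finset.range N, (N : ℝ) * |x| := by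
        refine norm_sum_le_of_le _ fun n hn => ?_
        rw [norm_sub_rev]
        refine (norm_phase_sub_one_le _).trans ?_
        rw [abs_mul, Nat.abs_cast]
        have : (n : ℝ) ≤ N := by exact_mod_cast (Finset.mem_range.1 hn).le
        gcongr
    _ = N * (N * |x|) := by simp

/-- Averaging `∑_{n < h + m} exp(i n x)` over its two splittings `h + m` and `m + h` makes the
factor `1 + exp(i h x)` appear. -/
lemma natCast_mul_norm_dirichletAvg_le {h N : ℕ} (hhN : h ≤ N) (hN : 0 < N) (x : ℝ) :
    N * ‖dirichletAvg N x‖ ≤ (N - h) * |Real.cos (h * x / 2)| + h := by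
  obtain ⟨m, rfl⟩ := Nat.exists_eq_add_of_le hhN
  rw [natCast_mul_norm_dirichletAvg hN]
  set G : ℕ → ℂ := fun k => ∑ n ∈ Finset.range k, phase (n * x)
  have hsplit : 2 * G (h + m) = (1 + phase (h * x)) * G m + (1 + phase (m * x)) * G h := by
    have h₁ : G (h + m) = G h + phase (h * x) * G m := sum_range_add_phase h m x
    have h₂ : G (h + m) = G m + phase (m * x) * G h := by
      rw [add_comm]; exact sum_range_add_phase m h x
    linear_combination h₁ + h₂
  have hm : ‖1 + phase (m * x)‖ ≤ 2 := by
    rw [norm_one_add_phase]; linarith [Real.abs_cos_le_one (m * x / 2)]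
  have hbound : 2 * ‖G (h + m)‖ ≤ 2 * |Real.cos (h * x / 2)| * m + 2 * h := by
    calc 2 * ‖G (h + m)‖ = ‖2 * G (h + m)‖ := by rw [norm_mul, Complex.norm_ofNat]
      _ ≤ ‖1 + phase (h * x)‖ * ‖G m‖ + ‖1 + phase (m * x)‖ * ‖G h‖ := by
        rw [hsplit, ← norm_mul, ← norm_mul]; exact norm_add_le _ _
      _ ≤ 2 * |Real.cos (h * x / 2)| * m + 2 * h := by
        rw [norm_one_add_phase]
        gcongr <;> exact norm_sum_range_phase_le _ x
  rw [Nat.cast_add, add_sub_cancel_left]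
  linarith

lemma abs_cos_le_one_sub_sq_div {y : ℝ} (hy₀ : 0 ≤ y) (hy : y ≤ 3 * π / 4) :
    |Real.cos y| ≤ 1 - y ^ 2 / 45 := by
  have hpi := Real.pi_gt_three
  have hconst : 1 / 5 ≤ 2 / π ^ 2 := by
    rw [div_le_div_iff₀ (by norm_num) (by positivity)]
    nlinarith [Real.pi_lt_d2]
  have hcos : Real.cos y ≤ 1 - 2 / π ^ 2 * y ^ 2 :=
    Real.cos_le_one_sub_mul_cos_sq (by rw [abs_le]; constructor <;> linarith)
  have hcos' : -Real.cos y ≤ 1 - 2 / π ^ 2 * (π - y) ^ 2 := by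
    rw [← Real.cos_pi_sub]
    exact Real.cos_le_one_sub_mul_cos_sq (by rw [abs_le]; constructor <;> linarith)
  have hsq : y ^ 2 ≤ (3 * (π - y)) ^ 2 := pow_le_pow_left₀ hy₀ (by linarith) 2
  have h₁ := mul_le_mul_of_nonneg_right hconst (sq_nonneg y)
  have h₂ := mul_le_mul_of_nonneg_right hconst (sq_nonneg (π - y))
  exact abs_le'.2 ⟨by linarith [sq_nonneg y], by linarith⟩

lemma sq_div_le_one_sub_norm_dirichletAvg {h N : ℕ} (hN : 0 < N) {x : ℝ}
    (hhN : (h : ℝ) ≤ 3 / 4 * N) (hx : h * |x| ≤ 3 * π / 2) :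
    (h * |x|) ^ 2 / 720 ≤ 1 - ‖dirichletAvg N x‖ := by
  have hN' : (0 : ℝ) < N := by exact_mod_cast hN
  have hle : h ≤ N := by
    have : (h : ℝ) ≤ N := by linarith
    exact_mod_cast this
  have hcos : |Real.cos (h * x / 2)| ≤ 1 - (h * |x| / 2) ^ 2 / 45 := by
    rw [← Real.cos_abs (h * x / 2), abs_div, abs_mul, Nat.abs_cast, abs_two]
    exact abs_cos_le_one_sub_sq_div (by positivity) (by linarith)
  have hshift := natCast_mul_norm_dirichletAvg_le hle hN x
  have hgain : (N : ℝ) / 4 * ((h * |x| / 2) ^ 2 / 45) ≤ (N - h) * ((h * |x| / 2) ^ 2 / 45) := by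
    gcongr; linarith
  have hmul := mul_le_mul_of_nonneg_left hcos (by linarith : (0 : ℝ) ≤ N - h)
  refine le_of_mul_le_mul_left (a := (N : ℝ)) ?_ hN'
  nlinarith

/-- For `N y ≤ 1` the shift is `⌊N / 2⌋`, otherwise it is about `1 / (4 y)`. -/
lemma exists_shift {N : ℕ} (hN : 2 ≤ N) {y : ℝ} (hy₀ : 0 ≤ y) (hy : y ≤ 3 * π / 2) :
    ∃ h : ℕ, (h : ℝ) ≤ 3 / 4 * N ∧ h * y ≤ 3 * π / 2 ∧ min 1 (N * y) ≤ 4 * (h * y) := by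
  have hpi := Real.pi_gt_three
  have hN' : (2 : ℝ) ≤ N := by exact_mod_cast hN
  rcases le_total (N * y) 1 with hNy | hNy
  · have hlow : (N : ℝ) ≤ 3 * (N / 2 : ℕ) := by
      have : N ≤ 3 * (N / 2) := by omega
      exact_mod_cast this
    have hup : ((N / 2 : ℕ) : ℝ) ≤ N / 2 := Nat.cast_div_le
    refine ⟨N / 2, by linarith, by nlinarith, (min_le_right _ _).trans ?_⟩
    nlinarith
  · have hy_pos : 0 < y := by
      by_contra! hle
      nlinarith
    have hle : 1 / (4 * y) ≤ ⌈1 / (4 * y)⌉₊ := Nat.le_ceil _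
    have hlt : (⌈1 / (4 * y)⌉₊ : ℝ) < 1 / (4 * y) + 1 := Nat.ceil_lt_add_one (by positivity)
    have hquarter : 1 / (4 * y) * y = 1 / 4 := by field_simp
    refine ⟨⌈1 / (4 * y)⌉₊, ?_, ?_, (min_le_left _ _).trans ?_⟩
    · have : 1 / (4 * y) ≤ N / 4 := by
        rw [div_le_div_iff₀ (by positivity) (by norm_num)]; linarith
      linarith
    · rcases le_or_gt (1 / 4) y with hbig | hsmall
      · have : ⌈1 / (4 * y)⌉₊ ≤ 1 := by
          rw [Nat.ceil_le, div_le_iff₀ (by positivity), Nat.cast_one]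
          linarith
        have : (⌈1 / (4 * y)⌉₊ : ℝ) ≤ 1 := by exact_mod_cast this
        nlinarith
      · nlinarith
    · nlinarith

lemma min_sq_div_le_one_sub_norm_dirichletAvg {N : ℕ} (hN : 2 ≤ N) {x : ℝ}
    (hx : |x| ≤ 3 * π / 2) : min 1 (N * |x|) ^ 2 / 11520 ≤ 1 - ‖dirichletAvg N x‖ := by
  obtain ⟨h, hhN, hhx, hmin⟩ := exists_shift hN (abs_nonneg x) hx
  have hsq : min 1 (N * |x|) ^ 2 ≤ (4 * (h * |x|)) ^ 2 :=
    pow_le_pow_left₀ (by positivity) hmin 2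
  refine le_trans ?_ (sq_div_le_one_sub_norm_dirichletAvg (by omega) hhN hhx)
  linarith

lemma sum_norm_sub_sq {ι V : Type*} [NormedAddCommGroup V] [InnerProductSpace ℝ V]
    (s : Finset ι) (a : ι → V) {m : V} (hm : ∑ i ∈ s, a i = (s.card : ℝ) • m) (r : V) :
    ∑ i ∈ s, ‖a i - r‖ ^ 2 =
      ∑ i ∈ s, ‖a i‖ ^ 2 - s.card * ‖m‖ ^ 2 + s.card * ‖r - m‖ ^ 2 := by
  simp only [norm_sub_sq_real, Finset.sum_add_distrib, Finset.sum_sub_distrib, ← Finset.mul_sum,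
    ← sum_inner, hm, inner_smul_left, Finset.sum_const, nsmul_eq_mul, real_inner_comm r m,
    conj_trivial]
  ring

/-- The correlation `N⁻¹ ∑_n Z_n exp(i n x)` of the data with a pure oscillation. For fixed
`θ = x / τ` it is the optimal amplitude in the least squares fit. -/
def correlation {N : ℕ} (Z : Fin N → ℂ) (x : ℝ) : ℂ :=
  (N : ℂ)⁻¹ * ∑ n : Fin N, Z n * phase ((n : ℕ) * x)

lemma norm_sub_mul_exp_neg (z r : ℂ) (τ θ : ℝ) (n : ℕ) :
    ‖z - r * Complex.exp (-(Complex.I * θ * n * τ))‖ = ‖z * phase (n * (θ * τ)) - r‖ := by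
  have hinv : Complex.exp (-(Complex.I * θ * n * τ)) * phase (n * (θ * τ)) = 1 := by
    rw [phase, ← Complex.exp_add, Complex.exp_eq_one_iff]
    exact ⟨0, by push_cast; ring⟩
  rw [← mul_one ‖z - _‖, ← norm_phase (n * (θ * τ)), ← norm_mul, sub_mul, mul_assoc, hinv,
    mul_one]

lemma loss_eq {N : ℕ} (hN : 0 < N) (Z : Fin N → ℂ) (τ : ℝ) (r : ℂ) (θ : ℝ) :
    loss Z τ r θ = (N : ℝ)⁻¹ * ∑ n, ‖Z n‖ ^ 2 - ‖correlation Z (θ * τ)‖ ^ 2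
      + ‖r - correlation Z (θ * τ)‖ ^ 2 := by
  have hN' : (N : ℝ) ≠ 0 := by exact_mod_cast hN.ne'
  have hmean : ∑ n : Fin N, Z n * phase ((n : ℕ) * (θ * τ))
      = ((Finset.univ : Finset (Fin N)).card : ℝ) • correlation Z (θ * τ) := by
    rw [Finset.card_univ, Fintype.card_fin, Complex.real_smul, Complex.ofReal_natCast, correlation,
      mul_inv_cancel_left₀ (by exact_mod_cast hN.ne')]
  simp only [loss, norm_sub_mul_exp_neg, sum_norm_sub_sq _ _ hmean, norm_mul, norm_phase, mul_one,
    Finset.card_univ, Fintype.card_fin]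
  field_simp

lemma norm_correlation_le_of_minimizer {N : ℕ} (hN : 0 < N) {Z : Fin N → ℂ} {τ : ℝ} {r : ℂ}
    {θ lam : ℝ} (h : ∀ r', loss Z τ r θ ≤ loss Z τ r' lam) :
    ‖correlation Z (lam * τ)‖ ≤ ‖correlation Z (θ * τ)‖ := by
  have hloss := h (correlation Z (lam * τ))
  rw [loss_eq hN, loss_eq hN, sub_self, norm_zero] at hloss
  exact le_of_sq_le_sq (by nlinarith [sq_nonneg ‖r - correlation Z (θ * τ)‖]) (norm_nonneg _)

/-- The average `N⁻¹ ∑_{n < N} w_n exp(i n x)`: the contribution of a perturbation `w` of the data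
to their correlation with a pure oscillation. -/
def phaseAvg (N : ℕ) (w : ℕ → ℂ) (x : ℝ) : ℂ :=
  (N : ℂ)⁻¹ * ∑ n ∈ Finset.range N, w n * phase (n * x)

lemma norm_phaseAvg_le_iff {N : ℕ} (hN : 0 < N) {w : ℕ → ℂ} {x σ : ℝ} :
    ‖phaseAvg N w x‖ ≤ σ ↔ ‖∑ n ∈ Finset.range N, w n * phase (n * x)‖ ≤ N * σ := by
  rw [phaseAvg, norm_mul, norm_inv, Complex.norm_natCast, inv_mul_le_iff₀ (Nat.cast_pos.2 hN)]

lemma norm_phaseAvg_le_of_forall {N : ℕ} (hN : 0 < N) {b : ℕ → ℂ} {β : ℝ}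
    (hb : ∀ n < N, ‖b n‖ ≤ β) (x : ℝ) : ‖phaseAvg N b x‖ ≤ β := by
  refine (norm_phaseAvg_le_iff hN).2 ?_
  calc _ ≤ ∑ _n ∈ Finset.range N, β := by
        refine norm_sum_le_of_le _ fun n hn => ?_
        rw [norm_mul, norm_phase, mul_one]
        exact hb n (Finset.mem_range.1 hn)
    _ = N * β := by simp

lemma correlation_eq {N : ℕ} {Z : Fin N → ℂ} {y : ℝ} {a : ℂ} {b w : ℕ → ℂ}
    (hZ : ∀ n : Fin N, Z n * phase ((n : ℕ) * y) = a + b n + w n) (x : ℝ) :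
    correlation Z (y + x) = a * dirichletAvg N x + phaseAvg N b x + phaseAvg N w x := by
  have hterm (n : Fin N) : Z n * phase ((n : ℕ) * (y + x))
      = (fun n : ℕ => (a + b n + w n) * phase (n * x)) n := by
    simp only [mul_add, phase_add, ← hZ, mul_assoc]
  rw [correlation, Finset.sum_congr rfl fun n _ => hterm n, Fin.sum_univ_eq_sum_range
    (fun n : ℕ => (a + b n + w n) * phase (n * x)), dirichletAvg, phaseAvg, phaseAvg]
  simp only [add_mul, Finset.sum_add_distrib, ← Finset.mul_sum]
  ring

lemma norm_phase_natCast_mul_sub_one_le (n : ℕ) (y : ℝ) : ‖phase (n * y) - 1‖ ≤ n * |y| := by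
  simpa only [abs_mul, Nat.abs_cast] using norm_phase_sub_one_le (n * y)

lemma norm_phase_succ_mul_sub_le (n : ℕ) (y : ℝ) :
    ‖phase ((n + 1 : ℕ) * y) - phase (n * y)‖ ≤ |y| := by
  have hfactor : phase ((n + 1 : ℕ) * y) - phase (n * y) = phase (n * y) * (phase y - 1) := by
    rw [Nat.cast_succ, add_mul, one_mul, phase_add]; ring
  rw [hfactor, norm_mul, norm_phase, one_mul]
  exact norm_phase_sub_one_le y

lemma norm_sum_mul_phase_sub_sum_le {w : ℕ → ℂ} {N : ℕ} {B : ℝ}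
    (hw : ∀ m ≤ N, ‖∑ n ∈ Finset.range m, w n‖ ≤ B) (y : ℝ) :
    ‖∑ n ∈ Finset.range N, w n * phase (n * y) - ∑ n ∈ Finset.range N, w n‖
      ≤ 2 * B * (N * |y|) := by
  have hB : 0 ≤ B := (norm_nonneg _).trans (hw 0 (Nat.zero_le _))
  set S : ℕ → ℂ := fun m => ∑ n ∈ Finset.range m, w n
  have habel : ∑ n ∈ Finset.range N, w n * phase (n * y) - S N
      = (phase ((N - 1 : ℕ) * y) - 1) * S N
        - ∑ n ∈ Finset.range (N - 1), (phase ((n + 1 : ℕ) * y) - phase (n * y)) * S (n + 1) := by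
    have := Finset.sum_range_by_parts (fun n : ℕ => phase (n * y)) w N
    simp only [smul_eq_mul] at this
    simp only [mul_comm (w _), this]
    ring
  have hN : ((N - 1 : ℕ) : ℝ) ≤ N := by exact_mod_cast Nat.sub_le N 1
  have hboundary : ‖(phase ((N - 1 : ℕ) * y) - 1) * S N‖ ≤ N * |y| * B := by
    rw [norm_mul]
    gcongr
    · exact (norm_phase_natCast_mul_sub_one_le _ y).trans (by gcongr)
    · exact hw N le_rfl
  have hsum : ‖∑ n ∈ Finset.range (N - 1), (phase ((n + 1 : ℕ) * y) - phase (n * y)) * S (n + 1)‖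
      ≤ N * (|y| * B) := by
    calc _ ≤ ∑ _n ∈ Finset.range (N - 1), |y| * B := by
          refine norm_sum_le_of_le _ fun n hn => ?_
          rw [norm_mul]
          have hn' : n + 1 ≤ N := by have := Finset.mem_range.1 hn; omega
          gcongr
          exacts [norm_phase_succ_mul_sub_le n y, hw _ hn']
      _ ≤ N * (|y| * B) := by
        rw [Finset.sum_const, Finset.card_range, nsmul_eq_mul]
        gcongr
  rw [habel]
  refine (norm_sub_le _ _).trans ?_
  linarith

/-- The frequencies `k / N` with `|k| ≤ 5 N`. They form a grid of mesh `1 / N`, which contains the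
frequencies `|x| ≤ 3π / 2` met by the algorithm. -/
abbrev grid (N : ℕ) : Finset ℤ := Finset.Icc (-(5 * N)) (5 * N)

/-- Uniform smallness of the partial exponential sums of a noise sequence on the grid. By summation
by parts it controls the full exponential sums off the grid, so a union bound over a finite set is
all the probability theory needed. -/
def SmallNoise (N : ℕ) (w : ℕ → ℂ) (σ : ℝ) : Prop :=
  ∀ m ≤ N, ∀ k ∈ grid N, ‖∑ n ∈ Finset.range m, w n * phase (n * ((k : ℝ) / N))‖ ≤ N * σ

section SmallNoise

variable {N : ℕ} {w : ℕ → ℂ} {σ : ℝ}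

lemma SmallNoise.norm_phaseAvg_grid_le (h : SmallNoise N w σ) (hN : 0 < N) {k : ℤ}
    (hk : k ∈ grid N) : ‖phaseAvg N w ((k : ℝ) / N)‖ ≤ σ :=
  (norm_phaseAvg_le_iff hN).2 (h N le_rfl k hk)

lemma SmallNoise.norm_phaseAvg_sub_le (h : SmallNoise N w σ) (hN : 0 < N) {k : ℤ}
    (hk : k ∈ grid N) (x : ℝ) :
    ‖phaseAvg N w x - phaseAvg N w ((k : ℝ) / N)‖ ≤ 2 * σ * (N * |x - k / N|) := by
  have habel := norm_sum_mul_phase_sub_sum_le (w := fun n => w n * phase (n * ((k : ℝ) / N)))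
    (fun m hm => h m hm k hk) (x - k / N)
  simp only [mul_assoc (w _), ← phase_add, ← mul_add, add_sub_cancel] at habel
  rw [phaseAvg, phaseAvg, ← mul_sub, norm_mul, norm_inv, Complex.norm_natCast,
    inv_mul_le_iff₀ (Nat.cast_pos.2 hN)]
  linarith

lemma SmallNoise.norm_phaseAvg_zero_le (h : SmallNoise N w σ) (hN : 0 < N) :
    ‖phaseAvg N w 0‖ ≤ σ := by
  simpa using h.norm_phaseAvg_grid_le hN (k := 0) (by simp)

lemma SmallNoise.norm_phaseAvg_sub_zero_le (h : SmallNoise N w σ) (hN : 0 < N) (x : ℝ) :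
    ‖phaseAvg N w x - phaseAvg N w 0‖ ≤ 2 * σ * (N * |x|) := by
  simpa using h.norm_phaseAvg_sub_le hN (k := 0) (by simp) x

lemma SmallNoise.norm_phaseAvg_le (h : SmallNoise N w σ) (hN : 0 < N) {x : ℝ}
    (hx : |x| ≤ 3 * π / 2) : ‖phaseAvg N w x‖ ≤ 3 * σ := by
  have hN' : (1 : ℝ) ≤ N := by exact_mod_cast hN
  obtain ⟨hx₁, hx₂⟩ := abs_le.1 hx
  have hfloor := Int.floor_le (N * x)
  have hfloor' := Int.lt_floor_add_one (N * x)
  set k := ⌊N * x⌋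
  have hk : k ∈ grid N := by
    have hpi := Real.pi_lt_d2
    rw [Finset.mem_Icc, Int.le_floor]
    have hup : (k : ℝ) ≤ ((5 * N : ℤ) : ℝ) := by push_cast; nlinarith
    exact ⟨by push_cast; nlinarith, by exact_mod_cast hup⟩
  have hdist : N * |x - k / N| ≤ 1 := by
    have hscale : x - k / N = (N * x - k) / N := by field_simp
    rw [hscale, abs_div, Nat.abs_cast, mul_div_cancel₀ _ (by positivity), abs_le]
    constructor <;> linarith
  have hgrid := h.norm_phaseAvg_grid_le hN hk
  have hσ : 0 ≤ σ := (norm_nonneg _).trans hgrid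
  calc ‖phaseAvg N w x‖
      ≤ ‖phaseAvg N w (k / N)‖ + ‖phaseAvg N w x - phaseAvg N w (k / N)‖ :=
        norm_le_norm_add_norm_sub' _ _
    _ ≤ σ + 2 * σ * (N * |x - k / N|) := add_le_add hgrid (h.norm_phaseAvg_sub_le hN hk x)
    _ ≤ 3 * σ := by nlinarith

end SmallNoise

lemma one_sub_norm_mul_norm_le {R : Type*} [SeminormedRing R] {a K f₀ f₁ : R}
    (h : ‖a + f₀‖ ≤ ‖a * K + f₁‖) : (1 - ‖K‖) * ‖a‖ ≤ ‖f₀‖ + ‖f₁‖ := by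
  have hlow := norm_sub_le_norm_add a f₀
  have hup := norm_add_le_of_le (norm_mul_le a K) (le_refl ‖f₁‖)
  linarith

lemma lt_of_min_sq_le {p δ β σ g u : ℝ} (hp : 0 < p) (hδ : 0 < δ) (hδ₁ : δ ≤ 1) (hu : 0 ≤ u)
    (hβ : β ≤ p * δ ^ 2 / 200000) (hσ : σ ≤ p * δ / 600000) (hg : min 1 u ^ 2 / 11520 ≤ g)
    (hnear : g * (p / 2) ≤ 2 * β + 3 * σ * u) (hfar : g * (p / 2) ≤ 2 * β + 4 * σ) : u < δ := by
  by_contra! hcon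
  have hgp : min 1 u ^ 2 / 11520 * (p / 2) ≤ g * (p / 2) := by gcongr
  rcases le_total u 1 with hu₁ | hu₁
  · rw [min_eq_right hu₁] at hgp
    have hσu : σ * u ≤ p * u ^ 2 / 600000 :=
      calc σ * u ≤ p * δ / 600000 * u := by gcongr
        _ ≤ p * u / 600000 * u := by gcongr
        _ = p * u ^ 2 / 600000 := by ring
    have hδu : p * δ ^ 2 ≤ p * u ^ 2 := by gcongr
    have hpos : 0 < p * u ^ 2 := mul_pos hp (pow_pos (hδ.trans_le hcon) 2)
    linarith
  · rw [min_eq_left hu₁] at hgp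
    have hpδ : p * δ ≤ p := mul_le_of_le_one_right hp.le hδ₁
    have hpδ_sq : p * δ ^ 2 ≤ p := mul_le_of_le_one_right hp.le (pow_le_one₀ hδ.le hδ₁)
    linarith

/-- The minimizer has the larger correlation. Far from `lam` this contradicts the decay of the
Dirichlet average. Near `lam` the noise enters only through its increment, which is `O(σ u)` with
`u = N τ |θ - lam|`: this is why noise of relative size `δ` suffices for precision `δ`. -/
lemma abs_sub_lt_of_minimizer {N : ℕ} (hN : 2 ≤ N) {Z : Fin N → ℂ} {τ lam θ δ p σ β : ℝ} {r a : ℂ}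
    {b w : ℕ → ℂ} (hτ : 0 < τ) (hδ : 0 < δ) (hδ₁ : δ ≤ 1) (hp : 0 < p) (ha : 3 / 4 * p ≤ ‖a‖)
    (hZ : ∀ n : Fin N, Z n * phase ((n : ℕ) * (lam * τ)) = a + b n + w n)
    (hb : ∀ n < N, ‖b n‖ ≤ β) (hβ : β ≤ p * δ ^ 2 / 200000)
    (hw : SmallNoise N w σ) (hσ : σ ≤ p * δ / 600000)
    (hmin : ∀ r', loss Z τ r θ ≤ loss Z τ r' lam) (hθ : |θ - lam| * τ ≤ 3 * π / 2) :
    |θ - lam| * (N * τ) < δ := by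
  have hN₀ : 0 < N := by omega
  have hcorr := norm_correlation_le_of_minimizer hN₀ hmin
  have hθτ : θ * τ = lam * τ + (θ - lam) * τ := by ring
  rw [hθτ, ← add_zero (lam * τ), correlation_eq hZ, add_zero, correlation_eq hZ,
    dirichletAvg_zero hN₀, mul_one] at hcorr
  set x := (θ - lam) * τ with hx
  have habs : |x| = |θ - lam| * τ := by rw [hx, abs_mul, abs_of_pos hτ]
  rw [mul_left_comm, ← habs]
  rw [← habs] at hθ
  set K := dirichletAvg N x
  set w₀ := phaseAvg N w 0
  have hw₀ : ‖w₀‖ ≤ σ := hw.norm_phaseAvg_zero_le hN₀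
  have hb₀ := norm_phaseAvg_le_of_forall hN₀ hb 0
  have hbx := norm_phaseAvg_le_of_forall hN₀ hb x
  have hnear : (1 - ‖K‖) * ‖a + w₀‖ ≤ 2 * β + 3 * σ * (N * |x|) := by
    have hdrift : ‖(phaseAvg N w x - w₀) + (1 - K) * w₀‖ ≤ 2 * σ * (N * |x|) + N * |x| * σ := by
      refine norm_add_le_of_le (hw.norm_phaseAvg_sub_zero_le hN₀ x) ((norm_mul_le _ _).trans ?_)
      gcongr
      exact norm_one_sub_dirichletAvg_le hN₀ x
    have hcorr' : ‖a + w₀ + phaseAvg N b 0‖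
        ≤ ‖(a + w₀) * K + (phaseAvg N b x + ((phaseAvg N w x - w₀) + (1 - K) * w₀))‖ := by
      convert hcorr using 2 <;> ring
    linarith [one_sub_norm_mul_norm_le hcorr', norm_add_le_of_le hbx hdrift]
  have hfar : (1 - ‖K‖) * ‖a‖ ≤ 2 * β + 4 * σ := by
    have := one_sub_norm_mul_norm_le (by simpa only [add_assoc] using hcorr)
    linarith [norm_add_le_of_le hb₀ hw₀, norm_add_le_of_le hbx (hw.norm_phaseAvg_le hN₀ hθ)]
  have hpδ : p * δ ≤ p := mul_le_of_le_one_right hp.le hδ₁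
  have hK : 0 ≤ 1 - ‖K‖ := sub_nonneg.2 (norm_dirichletAvg_le_one N x)
  have haw : p / 2 ≤ ‖a + w₀‖ := by linarith [norm_sub_le_norm_add a w₀]
  exact lt_of_min_sq_le hp hδ hδ₁ (by positivity) hβ hσ
    (min_sq_div_le_one_sub_norm_dirichletAvg hN hθ)
    ((mul_le_mul_of_nonneg_left haw hK).trans hnear)
    ((mul_le_mul_of_nonneg_left (by linarith) hK).trans hfar)

section Levels

variable {τ θ : ℕ → ℝ} {lam : ℝ}

lemma mem_searchInterval_succ {i : ℕ} (hτ : 0 < τ i) (h : |θ i - lam| * τ i ≤ 1 / 2) :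
    lam ∈ searchInterval τ θ (i + 1) := by
  refine Set.mem_Icc_iff_abs_le.1 ?_
  rw [le_div_iff₀ (by positivity)]
  linarith [Real.pi_gt_three]

lemma abs_sub_mul_le_of_mem_searchInterval_succ {i : ℕ} (hτ : 0 < τ i)
    (hτ_succ : τ (i + 1) = 2 * τ i) (h : |θ i - lam| * τ i ≤ 1 / 2) {t : ℝ}
    (ht : t ∈ searchInterval τ θ (i + 1)) : |t - lam| * τ (i + 1) ≤ 3 * π / 2 := by
  have hprev : |θ i - t| ≤ π / (2 * τ i) := Set.mem_Icc_iff_abs_le.2 ht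
  rw [abs_sub_comm, le_div_iff₀ (by positivity)] at hprev
  rw [hτ_succ]
  nlinarith [abs_sub_le t (θ i) lam, Real.pi_gt_three]

lemma abs_sub_mul_le_of_mem_Icc {t s : ℝ} (ht : t ∈ Set.Icc (-π) π) (hlam : lam ∈ Set.Icc (-π) π)
    (hs : 0 ≤ s) (hs_half : s ≤ 1 / 2) : |t - lam| * s ≤ 3 * π / 2 := by
  have habs : |t - lam| ≤ 2 * π := by
    rw [abs_le]; constructor <;> linarith [ht.1, ht.2, hlam.1, hlam.2]
  have := mul_le_mul habs hs_half hs (by positivity)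
  linarith [Real.pi_pos]

lemma IsRun.abs_sub_lt {J N : ℕ} (hN : 2 ≤ N) {Z : Fin J → Fin N → ℂ} {r : ℕ → ℂ} {δ : ℝ}
    (hrun : IsRun Z τ r θ) (hτ : ∀ i, 0 < τ i) (hτ_succ : ∀ i, τ (i + 1) = 2 * τ i)
    (hτ₀ : τ 0 ≤ 1 / 2) (hlam : lam ∈ Set.Icc (-π) π) (hδ₁ : δ ≤ 1)
    (hlevel : ∀ (i : Fin J) (r : ℂ) (θ : ℝ),
      (∀ r', loss (Z i) (τ i) r θ ≤ loss (Z i) (τ i) r' lam) →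
      |θ - lam| * τ i ≤ 3 * π / 2 → |θ - lam| * (N * τ i) < δ) :
    ∀ i < J, |θ i - lam| * (N * τ i) < δ := by
  intro i
  induction i with
  | zero =>
    intro hJ
    obtain ⟨hmem, hmin⟩ := hrun ⟨0, hJ⟩
    exact hlevel ⟨0, hJ⟩ _ _ (fun r' => hmin r' lam hlam)
      (abs_sub_mul_le_of_mem_Icc hmem hlam (hτ 0).le hτ₀)
  | succ i ih =>
    intro hJ
    obtain ⟨hmem, hmin⟩ := hrun ⟨i + 1, hJ⟩
    have hprev : |θ i - lam| * τ i ≤ 1 / 2 := by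
      have hN' : (2 : ℝ) ≤ N := by exact_mod_cast hN
      have : |θ i - lam| * (2 * τ i) ≤ |θ i - lam| * (N * τ i) := by
        gcongr; exact (hτ i).le
      linarith [ih (by omega)]
    exact hlevel ⟨i + 1, hJ⟩ _ _ (fun r' => hmin r' lam (mem_searchInterval_succ (hτ i) hprev))
      (abs_sub_mul_le_of_mem_searchInterval_succ (hτ i) (hτ_succ i) hprev hmem)

end Levels

section TimeStep

variable {ε δ : ℝ} {N : ℕ}

lemma timeStep_pos (hε : 0 < ε) (hδ : 0 < δ) (hN : 0 < N) (i : ℕ) : 0 < timeStep ε δ N i := by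
  unfold timeStep; positivity

lemma timeStep_succ (ε δ : ℝ) (N i : ℕ) : timeStep ε δ N (i + 1) = 2 * timeStep ε δ N i := by
  unfold timeStep
  rw [Nat.cast_add_one, add_sub_right_comm, zpow_add_one₀ (by norm_num)]
  ring

lemma timeStep_mono (hε : 0 < ε) (hδ : 0 < δ) (hN : 0 < N) : Monotone (timeStep ε δ N) :=
  monotone_nat_of_le_succ fun i => by
    rw [timeStep_succ]; linarith [timeStep_pos hε hδ hN i]

lemma mul_timeStep_last (hN : 0 < N) (ε δ : ℝ) :
    N * timeStep ε δ N (numLevels ε - 1) = δ / ε := by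
  have hN' : (N : ℝ) ≠ 0 := by exact_mod_cast hN.ne'
  simp only [timeStep, numLevels, Nat.add_sub_cancel, sub_self, zpow_zero, one_mul]
  rw [← mul_div_assoc, mul_div_mul_left _ _ hN']

lemma timeStep_zero_le (hε : 0 < ε) (hδ : 0 ≤ δ) : timeStep ε δ N 0 ≤ δ / N := by
  have hpow : (2 : ℝ) ^ ((0 : ℕ) - (⌈Real.logb 2 (1 / ε)⌉₊ : ℤ)) ≤ ε := by
    have hceil := Nat.le_ceil (Real.logb 2 (1 / ε))
    rw [Real.logb_le_iff_le_rpow (by norm_num) (by positivity), Real.rpow_natCast] at hceil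
    rw [Nat.cast_zero, zero_sub, zpow_neg, zpow_natCast, inv_le_comm₀ (by positivity) hε]
    exact (one_div ε).symm.trans_le hceil
  calc timeStep ε δ N 0 ≤ ε * (δ / (N * ε)) := by
        unfold timeStep; gcongr
    _ = δ / N := by
      rw [mul_comm (N : ℝ), ← mul_div_assoc, mul_div_mul_left _ _ hε.ne']

end TimeStep

section Circuit

variable {E : Type*} [NormedAddCommGroup E]

lemma exp_apply_of_eigenvector {𝕜 : Type*} [RCLike 𝕜] [NormedSpace 𝕜 E] [CompleteSpace E]
    {T : E →L[𝕜] E} {x : E} {μ : 𝕜} (h : T x = μ • x) :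
    NormedSpace.exp T x = NormedSpace.exp μ • x := by
  have hpow : ∀ n : ℕ, (T ^ n) x = μ ^ n • x := by
    intro n
    induction n with
    | zero => simp
    | succ n ih => rw [pow_succ, mul_apply_eq_comp, h, map_smul, ih, smul_smul, pow_succ']
  have hT := (NormedSpace.exp_series_hasSum_exp' (𝕂 := 𝕜) T).mapL (.apply 𝕜 E x)
  have hμ := (NormedSpace.exp_series_hasSum_exp' (𝕂 := 𝕜) μ).smul_const x
  refine hT.unique ?_
  simpa only [ContinuousLinearMap.apply_apply, smul_apply, hpow, smul_assoc] using hμ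

variable [InnerProductSpace ℂ E] {M : ℕ} {H : E →L[ℂ] E}
  {v : OrthonormalBasis (Fin (M + 1)) ℂ E} {lam : Fin (M + 1) → ℝ} {ψ : E}

lemma IsEigensystem.evolution_apply (h : IsEigensystem H v lam) (t : ℝ) (m : Fin (M + 1)) :
    evolution H t (v m) = phase (-(t * lam m)) • v m := by
  have : FiniteDimensional ℂ E := v.toBasis.finiteDimensional_of_finite
  have : CompleteSpace E := FiniteDimensional.complete ℂ E
  have hm : ((-(Complex.I * (t : ℂ))) • H) (v m) = (-(Complex.I * (t : ℂ)) * lam m) • v m := by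
    rw [smul_apply, h m, smul_smul]
  rw [evolution, exp_apply_of_eigenvector hm, ← Complex.exp_eq_exp_ℂ, phase]
  congr 2
  push_cast
  ring

lemma IsEigensystem.inner_evolution (h : IsEigensystem H v lam) (t : ℝ) (m : Fin (M + 1)) (ψ : E) :
    inner ℂ (v m) (evolution H t ψ) = phase (-(t * lam m)) * inner ℂ (v m) ψ := by
  have hexpand : evolution H t ψ = ∑ k, (inner ℂ (v k) ψ * phase (-(t * lam k))) • v k := by
    conv_lhs => rw [← v.sum_repr' ψ]
    simp only [map_sum, map_smul, h.evolution_apply, smul_smul]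
  rw [hexpand, v.orthonormal.inner_right_fintype, mul_comm]

lemma IsEigensystem.norm_evolution (h : IsEigensystem H v lam) (t : ℝ) (ψ : E) :
    ‖evolution H t ψ‖ = ‖ψ‖ := by
  have hsum := v.sum_sq_norm_inner_right (evolution H t ψ)
  simp only [h.inner_evolution, norm_mul, norm_phase, one_mul, v.sum_sq_norm_inner_right] at hsum
  exact ((sq_eq_sq₀ (norm_nonneg _) (norm_nonneg _)).1 hsum).symm

lemma sum_overlap (hψ : ‖ψ‖ = 1) : ∑ m, overlap v ψ m = 1 :=
  (v.sum_sq_norm_inner_right ψ).trans (by rw [hψ, one_pow])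

lemma overlap_nonneg (v : OrthonormalBasis (Fin (M + 1)) ℂ E) (ψ : E) (m : Fin (M + 1)) :
    0 ≤ overlap v ψ m :=
  sq_nonneg _

lemma IsEigensystem.inner_self_evolution (h : IsEigensystem H v lam) (t : ℝ) (ψ : E) :
    inner ℂ ψ (evolution H t ψ) = ∑ m, (overlap v ψ m : ℂ) * phase (-(t * lam m)) := by
  rw [← v.sum_inner_mul_inner ψ (evolution H t ψ)]
  refine Finset.sum_congr rfl fun m _ => ?_
  rw [h.inner_evolution, overlap, ← inner_conj_symm, mul_left_comm,
    ← Complex.normSq_eq_conj_mul_self, Complex.normSq_eq_norm_sq, mul_comm]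

lemma circuitState_eq (H : E →L[ℂ] E) (ψ : E) (w : ℂ) (t : ℝ) :
    circuitState H ψ w t =
      ((1 / 2 : ℂ) • (ψ + w • evolution H t ψ), (1 / 2 : ℂ) • (ψ - w • evolution H t ψ)) := by
  have hhalf : (((√2)⁻¹ : ℝ) : ℂ) * (((√2)⁻¹ : ℝ) : ℂ) = 1 / 2 := by
    rw [← Complex.ofReal_mul, ← mul_inv, Real.mul_self_sqrt (by norm_num)]
    norm_num
  simp only [circuitState, hadamardGate, ancillaPhase, controlled, add_zero, sub_zero, map_smul]
  rw [smul_comm w, ← smul_add, ← smul_sub, smul_smul, smul_smul, hhalf]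

lemma IsEigensystem.sq_norm_circuitState_add (h : IsEigensystem H v lam) (hψ : ‖ψ‖ = 1) {w : ℂ}
    (hw : ‖w‖ = 1) (t : ℝ) :
    ‖(circuitState H ψ w t).1‖ ^ 2 + ‖(circuitState H ψ w t).2‖ ^ 2 = 1 := by
  have hpar := parallelogram_law_with_norm ℂ ψ (w • evolution H t ψ)
  rw [norm_smul w, hw, h.norm_evolution, hψ] at hpar
  rw [circuitState_eq, norm_smul, norm_smul]
  norm_num
  linarith

lemma sq_norm_circuitState_sub (H : E →L[ℂ] E) (ψ : E) (w : ℂ) (t : ℝ) :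
    ‖(circuitState H ψ w t).1‖ ^ 2 - ‖(circuitState H ψ w t).2‖ ^ 2
      = (w * inner ℂ ψ (evolution H t ψ)).re := by
  rw [circuitState_eq, norm_smul, norm_smul, mul_pow, mul_pow, @norm_add_sq ℂ, @norm_sub_sq ℂ,
    inner_smul_right, RCLike.re_eq_complex_re]
  norm_num
  ring

instance isFiniteMeasure_circuitLaw (H : E →L[ℂ] E) (ψ : E) (w : ℂ) (t : ℝ) :
    IsFiniteMeasure (circuitLaw H ψ w t) := by
  have := Measure.smul_finite (Measure.dirac (0 : Fin 2))
    (ENNReal.ofReal_ne_top (r := ‖(circuitState H ψ w t).1‖ ^ 2))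
  have := Measure.smul_finite (Measure.dirac (1 : Fin 2))
    (ENNReal.ofReal_ne_top (r := ‖(circuitState H ψ w t).2‖ ^ 2))
  unfold circuitLaw
  infer_instance

lemma IsEigensystem.isProbabilityMeasure_circuitLaw (h : IsEigensystem H v lam) (hψ : ‖ψ‖ = 1)
    {w : ℂ} (hw : ‖w‖ = 1) (t : ℝ) : IsProbabilityMeasure (circuitLaw H ψ w t) := by
  constructor
  simp only [circuitLaw, Measure.coe_add, Measure.coe_smul, Pi.add_apply, Pi.smul_apply,
    measure_univ, smul_eq_mul, mul_one]
  rw [← ENNReal.ofReal_add (by positivity) (by positivity), h.sq_norm_circuitState_add hψ hw,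
    ENNReal.ofReal_one]

lemma integral_outcomeSign (H : E →L[ℂ] E) (ψ : E) (w : ℂ) (t : ℝ) :
    ∫ o, (outcomeSign o : ℂ) ∂(circuitLaw H ψ w t)
      = ((w * inner ℂ ψ (evolution H t ψ)).re : ℂ) := by
  rw [← sq_norm_circuitState_sub, circuitLaw, integral_add_measure, integral_smul_measure,
    integral_smul_measure, integral_dirac, integral_dirac, ENNReal.toReal_ofReal (by positivity),
    ENNReal.toReal_ofReal (by positivity)]
  · simp [outcomeSign, sub_eq_add_neg]
  · exact Integrable.of_finite.smul_measure ENNReal.ofReal_ne_top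
  · exact Integrable.of_finite.smul_measure ENNReal.ofReal_ne_top

/-- With `S†` the outcome sign has mean `Re (-i z) = Im z`. -/
lemma IsEigensystem.integral_outcomeSign_add_I_mul (h : IsEigensystem H v lam) (hψ : ‖ψ‖ = 1)
    (t : ℝ) :
    ∫ o : Fin 2 × Fin 2, ((outcomeSign o.1 : ℂ) + Complex.I * (outcomeSign o.2 : ℂ))
      ∂(circuitLaw H ψ 1 t).prod (circuitLaw H ψ (-Complex.I) t)
      = inner ℂ ψ (evolution H t ψ) := by
  have := h.isProbabilityMeasure_circuitLaw hψ (w := 1) (by simp) t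
  have := h.isProbabilityMeasure_circuitLaw hψ (w := -Complex.I) (by simp) t
  rw [integral_add .of_finite .of_finite, integral_const_mul,
    integral_fun_fst fun o => (outcomeSign o : ℂ), integral_fun_snd fun o => (outcomeSign o : ℂ),
    integral_outcomeSign, integral_outcomeSign]
  apply Complex.ext <;> simp

variable {d : ℕ} {F : Freq d → ℂ}

lemma filterNorm_nonneg (F : Freq d → ℂ) : 0 ≤ filterNorm F :=
  Finset.sum_nonneg fun _ _ => norm_nonneg _

lemma filterEval_eq_sum_phase (F : Freq d → ℂ) (x : ℝ) :
    filterEval F x = ∑ l, F l * phase (-((l : ℤ) * x)) := by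
  refine Finset.sum_congr rfl fun l _ => ?_
  rw [phase]
  push_cast
  ring_nf

lemma norm_filterEval_le (F : Freq d → ℂ) (x : ℝ) : ‖filterEval F x‖ ≤ filterNorm F := by
  rw [filterEval_eq_sum_phase]
  exact norm_sum_le_of_le _ fun l _ => by rw [norm_mul, norm_phase, mul_one]

lemma IsEigensystem.isProbabilityMeasure_sampleLaw (h : IsEigensystem H v lam) (hψ : ‖ψ‖ = 1)
    (hF : 0 < filterNorm F) (t : ℝ) : IsProbabilityMeasure (sampleLaw H ψ F t) := by
  have hId := h.isProbabilityMeasure_circuitLaw hψ (w := 1) (by simp)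
  have hSdg := h.isProbabilityMeasure_circuitLaw hψ (w := -Complex.I) (by simp)
  constructor
  simp only [sampleLaw, Measure.finsetSum_apply, Measure.smul_apply, measure_univ, smul_eq_mul,
    mul_one]
  rw [← ENNReal.ofReal_sum_of_nonneg fun l _ => div_nonneg (norm_nonneg _) hF.le,
    ← Finset.sum_div, ← filterNorm, div_self hF.ne', ENNReal.ofReal_one]

lemma norm_sampleValue_le (F : Freq d → ℂ) (s : Sample d) :
    ‖sampleValue F s‖ ≤ 2 * filterNorm F := by
  have hsign : ∀ o, ‖(outcomeSign o : ℂ)‖ = 1 := by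
    intro o; unfold outcomeSign; split_ifs <;> simp
  have hsum : ‖(outcomeSign s.2.1 : ℂ) + Complex.I * (outcomeSign s.2.2 : ℂ)‖ ≤ 2 := by
    refine (norm_add_le _ _).trans ?_
    rw [norm_mul, hsign, hsign, Complex.norm_I]
    norm_num
  rw [sampleValue, norm_mul, norm_mul, ← phase, norm_phase, mul_one, Complex.norm_real,
    Real.norm_of_nonneg (filterNorm_nonneg F)]
  exact mul_le_mul_of_nonneg_right hsum (filterNorm_nonneg F)

lemma integral_sampleLaw (H : E →L[ℂ] E) (ψ : E) (F : Freq d → ℂ) (t : ℝ) (f : Sample d → ℂ) :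
    ∫ s, f s ∂(sampleLaw H ψ F t) = ∑ l : Freq d, ((‖F l‖ / filterNorm F : ℝ) : ℂ) *
      ∫ o, f (l, o) ∂(circuitLaw H ψ 1 (((l : ℤ) : ℝ) + t)).prod
        (circuitLaw H ψ (-Complex.I) (((l : ℤ) : ℝ) + t)) := by
  rw [sampleLaw, integral_finsetSum_measure fun l _ =>
    Integrable.of_finite.smul_measure ENNReal.ofReal_ne_top]
  refine Finset.sum_congr rfl fun l _ => ?_
  rw [integral_smul_measure, integral_prod _ .of_finite, integral_dirac, ENNReal.toReal_ofReal
    (div_nonneg (norm_nonneg _) (filterNorm_nonneg F)), Complex.real_smul]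

lemma IsEigensystem.integral_sampleValue_eq_sum_inner (h : IsEigensystem H v lam) (hψ : ‖ψ‖ = 1)
    (hF : 0 < filterNorm F) (t : ℝ) :
    ∫ s, sampleValue F s ∂(sampleLaw H ψ F t)
      = ∑ l : Freq d, F l * inner ℂ ψ (evolution H ((l : ℤ) + t) ψ) := by
  rw [integral_sampleLaw]
  refine Finset.sum_congr rfl fun l _ => ?_
  simp only [sampleValue, integral_mul_const, h.integral_outcomeSign_add_I_mul hψ]
  have hne : (filterNorm F : ℂ) ≠ 0 := by exact_mod_cast hF.ne'
  conv_rhs => rw [← Complex.norm_mul_exp_arg_mul_I (F l)]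
  rw [mul_comm Complex.I]
  push_cast
  field_simp

lemma IsEigensystem.integral_sampleValue (h : IsEigensystem H v lam) (hψ : ‖ψ‖ = 1)
    (hF : 0 < filterNorm F) (t : ℝ) :
    ∫ s, sampleValue F s ∂(sampleLaw H ψ F t)
      = ∑ m, (overlap v ψ m : ℂ) * filterEval F (lam m) * phase (-(t * lam m)) := by
  simp only [h.integral_sampleValue_eq_sum_inner hψ hF, h.inner_self_evolution,
    filterEval_eq_sum_phase, Finset.mul_sum, Finset.sum_mul]
  rw [Finset.sum_comm]
  refine Finset.sum_congr rfl fun m _ => Finset.sum_congr rfl fun l _ => ?_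
  rw [add_mul, neg_add, phase_add]
  ring

/-- The contribution of the eigenvalues other than `lam 0` to the expected data at time `t`. -/
def bias (v : OrthonormalBasis (Fin (M + 1)) ℂ E) (lam : Fin (M + 1) → ℝ) (ψ : E)
    (F : Freq d → ℂ) (t : ℝ) : ℂ :=
  ∑ m ∈ Finset.univ.erase 0, (overlap v ψ m : ℂ) * filterEval F (lam m) * phase (-(t * lam m))

lemma IsEigensystem.integral_sampleValue_eq_add_bias (h : IsEigensystem H v lam)
    (hψ : ‖ψ‖ = 1) (hF : 0 < filterNorm F) (t : ℝ) :
    ∫ s, sampleValue F s ∂(sampleLaw H ψ F t)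
      = (overlap v ψ 0 : ℂ) * filterEval F (lam 0) * phase (-(t * lam 0)) + bias v lam ψ F t := by
  rw [h.integral_sampleValue hψ hF]
  exact (Finset.add_sum_erase _ _ (Finset.mem_univ 0)).symm

variable {I I' : Set ℝ}

lemma sum_erase_indicator_overlap_le {ρ : ℝ} (h₀ : 0 < overlap v ψ 0) (hI : lam 0 ∈ I)
    (hI' : lam 0 ∈ I') (hρ : 1 - relOverlap v lam ψ I I' ≤ ρ) (hρ_half : ρ ≤ 1 / 2) :
    ∑ k ∈ Finset.univ.erase 0, I'.indicator (fun _ => overlap v ψ k) (lam k)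
      ≤ 2 * ρ * overlap v ψ 0 := by
  have hrest : 0 ≤ ∑ k ∈ Finset.univ.erase 0, I'.indicator (fun _ => overlap v ψ k) (lam k) :=
    Finset.sum_nonneg fun k _ => Set.indicator_nonneg (fun _ _ => overlap_nonneg v ψ k) _
  rw [relOverlap, Set.indicator_of_mem hI, ← Finset.add_sum_erase _ _ (Finset.mem_univ 0),
    Set.indicator_of_mem hI', sub_le_comm, le_div_iff₀ (by linarith)] at hρ
  nlinarith

lemma IsFilter.norm_filterEval_mul_le {q p x : ℝ} (hF : IsFilter F q I I')
    (hx : x ∈ Set.Icc (-π) π) (hp : 0 ≤ p) (hq : 0 ≤ q) :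
    p * ‖filterEval F x‖ ≤ (1 + q) * I'.indicator (fun _ => p) x + q * p := by
  obtain ⟨-, hout, hbdd⟩ := hF
  by_cases hmem : x ∈ I'
  · rw [Set.indicator_of_mem hmem]
    nlinarith [hbdd x]
  · rw [Set.indicator_of_notMem hmem]
    nlinarith [hout x ⟨hx, hmem⟩]

lemma IsFilter.error_nonneg {q x : ℝ} (hF : IsFilter F q I I') (hx : x ∈ I) : 0 ≤ q :=
  (norm_nonneg _).trans (hF.1 x hx)

lemma norm_bias_le (hψ : ‖ψ‖ = 1) {q ρ : ℝ} (hlam : ∀ m, lam m ∈ Set.Icc (-π) π)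
    (h₀ : 0 < overlap v ψ 0) (hI : lam 0 ∈ I) (hI' : lam 0 ∈ I') (hF : IsFilter F q I I')
    (hρ : 1 - relOverlap v lam ψ I I' ≤ ρ) (hρ_half : ρ ≤ 1 / 2) (t : ℝ) :
    ‖bias v lam ψ F t‖ ≤ (1 + q) * (2 * ρ * overlap v ψ 0) + q := by
  have hq := hF.error_nonneg hI
  have hrest : ∑ m ∈ Finset.univ.erase 0, overlap v ψ m ≤ 1 :=
    sum_overlap (v := v) hψ ▸ Finset.sum_le_sum_of_subset_of_nonneg (Finset.erase_subset _ _)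
      fun m _ _ => overlap_nonneg v ψ m
  calc ‖bias v lam ψ F t‖
      ≤ ∑ m ∈ Finset.univ.erase 0,
          ((1 + q) * I'.indicator (fun _ => overlap v ψ m) (lam m) + q * overlap v ψ m) := by
        refine norm_sum_le_of_le _ fun m _ => ?_
        rw [norm_mul, norm_mul, norm_phase, mul_one, Complex.norm_real,
          Real.norm_of_nonneg (overlap_nonneg v ψ m)]
        exact hF.norm_filterEval_mul_le (hlam m) (overlap_nonneg v ψ m) hq
    _ ≤ (1 + q) * (2 * ρ * overlap v ψ 0) + q * 1 := by
        rw [Finset.sum_add_distrib, ← Finset.mul_sum, ← Finset.mul_sum]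
        gcongr
        exact sum_erase_indicator_overlap_le h₀ hI hI' hρ hρ_half
    _ = _ := by rw [mul_one]

end Circuit

section Concentration

variable {ι Ω : Type*} [Fintype ι] [MeasurableSpace Ω] {μ : ι → Measure Ω}
  [∀ i, IsProbabilityMeasure (μ i)]

lemma hasSubgaussianMGF_eval_sub_integral {f : ι → Ω → ℝ} (hf : ∀ i, Measurable (f i)) {B : ℝ}
    (hfB : ∀ i x, |f i x| ≤ B) (i : ι) :
    ProbabilityTheory.HasSubgaussianMGF (fun ω : ι → Ω => f i (ω i) - ∫ x, f i x ∂(μ i))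
      ((‖B - (-B)‖₊ / 2) ^ 2) (Measure.pi μ) := by
  refine .of_map (X := fun x => f i x - ∫ x, f i x ∂(μ i)) (measurable_pi_apply i).aemeasurable ?_
  rw [(measurePreserving_eval μ i).map_eq]
  exact ProbabilityTheory.hasSubgaussianMGF_of_mem_Icc (hf i).aemeasurable
    (ae_of_all _ fun x => abs_le.1 (hfB i x))

lemma measureReal_le_sum_sub_integral {f : ι → Ω → ℝ} (hf : ∀ i, Measurable (f i)) {B t : ℝ}
    (hB : 0 < B) (hfB : ∀ i x, |f i x| ≤ B) (ht : 0 < t) (s : Finset ι) {n : ℕ} (hs : s.card ≤ n) :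
    (Measure.pi μ).real {ω | t ≤ ∑ i ∈ s, (f i (ω i) - ∫ x, f i x ∂(μ i))}
      ≤ Real.exp (-t ^ 2 / (2 * (n * B ^ 2))) := by
  rcases s.eq_empty_or_nonempty with rfl | hne
  · simp [ht.not_ge, Real.exp_nonneg]
  have hindep := ProbabilityTheory.iIndepFun_pi (μ := μ)
    (X := fun i x => f i x - ∫ x, f i x ∂(μ i)) fun i => ((hf i).sub_const _).aemeasurable
  refine (ProbabilityTheory.HasSubgaussianMGF.measure_sum_ge_le_of_iIndepFun hindep
    (fun i _ => hasSubgaussianMGF_eval_sub_integral hf hfB i) ht.le).trans ?_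
  have hvar : ∑ i ∈ s, (((‖B - (-B)‖₊ / 2) ^ 2 : NNReal) : ℝ) = s.card * B ^ 2 := by
    rw [Finset.sum_const, nsmul_eq_mul, NNReal.coe_pow, NNReal.coe_div, coe_nnnorm,
      sub_neg_eq_add, Real.norm_of_nonneg (by linarith), NNReal.coe_ofNat, add_self_div_two]
  have : (0 : ℝ) < s.card := by exact_mod_cast hne.card_pos
  rw [NNReal.coe_sum, hvar, Real.exp_le_exp, neg_div, neg_div, neg_le_neg_iff]
  gcongr

lemma setOf_lt_norm_subset {Ω : Type*} (W : Ω → ℂ) (t : ℝ) :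
    {ω | t < ‖W ω‖} ⊆ ({ω | t / 2 ≤ (W ω).re} ∪ {ω | t / 2 ≤ -(W ω).re}) ∪
      ({ω | t / 2 ≤ (W ω).im} ∪ {ω | t / 2 ≤ -(W ω).im}) := by
  intro ω hω
  by_contra! hsmall
  simp only [Set.mem_union, Set.mem_ofPred_eq, not_or, not_le] at hsmall hω
  obtain ⟨⟨hre, hre_neg⟩, him, him_neg⟩ := hsmall
  have hre_abs : |(W ω).re| < t / 2 := abs_lt.2 ⟨by linarith, hre⟩
  have him_abs : |(W ω).im| < t / 2 := abs_lt.2 ⟨by linarith, him⟩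
  linarith [Complex.norm_le_abs_re_add_abs_im (W ω)]

lemma measureReal_le_apply_sum_sub_integral {G : Type*} [NormedAddCommGroup G] [NormedSpace ℝ G]
    [CompleteSpace G] [SecondCountableTopology G] [MeasurableSpace G] [BorelSpace G]
    {g : ι → Ω → G} (hg : ∀ i, Measurable (g i)) {B t : ℝ}
    (hB : 0 < B) (hgB : ∀ i x, ‖g i x‖ ≤ B) (ht : 0 < t) (s : Finset ι) {n : ℕ} (hs : s.card ≤ n)
    (L : G →L[ℝ] ℝ) (hL : ∀ z, |L z| ≤ ‖z‖) :
    (Measure.pi μ).real {ω | t ≤ L (∑ i ∈ s, (g i (ω i) - ∫ x, g i x ∂(μ i)))}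
      ≤ Real.exp (-t ^ 2 / (2 * (n * B ^ 2))) := by
  have hint : ∀ i, Integrable (g i) (μ i) := fun i =>
    .of_bound (hg i).aestronglyMeasurable B (ae_of_all _ (hgB i))
  have hreal := measureReal_le_sum_sub_integral (μ := μ) (f := fun i x => L (g i x))
    (fun i => L.measurable.comp (hg i)) hB (fun i x => (hL _).trans (hgB i x)) ht s hs
  simpa only [L.integral_comp_comm (hint _), map_sum, map_sub] using hreal

lemma measureReal_lt_norm_sum_sub_integral {g : ι → Ω → ℂ} (hg : ∀ i, Measurable (g i)) {B t : ℝ}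
    (hB : 0 < B) (hgB : ∀ i x, ‖g i x‖ ≤ B) (ht : 0 < t) (s : Finset ι) {n : ℕ}
    (hs : s.card ≤ n) :
    (Measure.pi μ).real {ω | t < ‖∑ i ∈ s, (g i (ω i) - ∫ x, g i x ∂(μ i))‖}
      ≤ 4 * Real.exp (-t ^ 2 / (8 * (n * B ^ 2))) := by
  have hexp : -(t / 2) ^ 2 / (2 * (n * B ^ 2)) = -t ^ 2 / (8 * (n * B ^ 2)) := by
    rw [div_pow, ← neg_div, div_div, ← mul_assoc]; norm_num
  have htail := measureReal_le_apply_sum_sub_integral (μ := μ) hg hB hgB (half_pos ht) s hs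
  rw [hexp] at htail
  have hre := htail Complex.reCLM Complex.abs_re_le_norm
  have hre_neg := htail (-Complex.reCLM) fun z => by simpa using Complex.abs_re_le_norm z
  have him := htail Complex.imCLM Complex.abs_im_le_norm
  have him_neg := htail (-Complex.imCLM) fun z => by simpa using Complex.abs_im_le_norm z
  refine (measureReal_mono (setOf_lt_norm_subset _ t)).trans ((measureReal_union_le _ _).trans
    ((add_le_add (measureReal_union_le _ _) (measureReal_union_le _ _)).trans ?_))
  simp only [neg_apply, Complex.reCLM_apply, Complex.imCLM_apply] at hre hre_neg him him_neg
  linarith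

end Concentration

section Noise

variable {E : Type*} [NormedAddCommGroup E] [InnerProductSpace ℂ E] {M : ℕ} {H : E →L[ℂ] E}
  {v : OrthonormalBasis (Fin (M + 1)) ℂ E} {lam : Fin (M + 1) → ℝ} {ψ : E}
  {d J N Ns : ℕ} {F : Freq d → ℂ}

/-- Deviation of the data at level `i` from its mean, rotated so that an eigenvalue `x` becomes the
frequency zero; extended by zero to `N ≤ n`. -/
def noise (H : E →L[ℂ] E) (ψ : E) (F : Freq d → ℂ) (τ : ℕ → ℝ) (x : ℝ)
    (ω : Outcomes d J N Ns) (i : Fin J) (n : ℕ) : ℂ :=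
  if h : n < N then (filteredData F ω i ⟨n, h⟩
    - ∫ s, sampleValue F s ∂(sampleLaw H ψ F ((n : ℝ) * τ i))) * phase (n * (x * τ i))
  else 0

/-- The runs of level `i` that contribute to the data points `n < m`. -/
def runsBefore (i : Fin J) (m : ℕ) : Finset (Fin J × Fin N × Fin Ns) :=
  {i} ×ˢ (Finset.univ.filter (fun n : Fin N => (n : ℕ) < m) ×ˢ Finset.univ)

lemma card_runsBefore_le (i : Fin J) (m : ℕ) :
    (runsBefore i m : Finset (Fin J × Fin N × Fin Ns)).card ≤ N * Ns := by
  rw [runsBefore, Finset.card_product, Finset.card_product, Finset.card_singleton, one_mul,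
    Finset.card_univ, Fintype.card_fin]
  exact Nat.mul_le_mul_right _ (Finset.card_le_univ _ |>.trans_eq (Fintype.card_fin N))

lemma sum_range_dite_eq_sum_filter {G : Type*} [AddCommMonoid G] {m : ℕ} (hm : m ≤ N)
    (f : Fin N → G) :
    ∑ n ∈ Finset.range m, (if h : n < N then f ⟨n, h⟩ else 0)
      = ∑ n ∈ Finset.univ.filter (fun n : Fin N => (n : ℕ) < m), f n := by
  refine (Finset.sum_nbij (fun n : Fin N => (n : ℕ)) (by simp) Fin.val_injective.injOn
    (fun k hk => ?_) (fun n _ => by simp)).symm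
  have hkm : k < m := by simpa using hk
  exact ⟨⟨k, hkm.trans_le hm⟩, by simpa using hkm, rfl⟩

lemma natCast_mul_sum_noise_mul_phase (hNs : 0 < Ns) (H : E →L[ℂ] E) (ψ : E) (τ : ℕ → ℝ) (x y : ℝ)
    (i : Fin J) {m : ℕ} (hm : m ≤ N) (ω : Outcomes d J N Ns) :
    (Ns : ℂ) * ∑ n ∈ Finset.range m, noise H ψ F τ x ω i n * phase (n * y)
      = ∑ a ∈ runsBefore i m,
        (sampleValue F (ω a) * phase (((a.2.1 : ℕ) : ℝ) * (x * τ a.1 + y))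
          - ∫ s, sampleValue F s * phase (((a.2.1 : ℕ) : ℝ) * (x * τ a.1 + y))
            ∂(sampleLaw H ψ F (((a.2.1 : ℕ) : ℝ) * τ a.1))) := by
  have hterm (n : ℕ) : noise H ψ F τ x ω i n * phase (n * y) = if h : n < N then
      (filteredData F ω i ⟨n, h⟩ - ∫ s, sampleValue F s ∂(sampleLaw H ψ F ((n : ℝ) * τ i)))
        * phase (n * (x * τ i + y)) else 0 := by
    unfold noise
    split_ifs
    · rw [mul_assoc, ← phase_add, ← mul_add]
    · exact zero_mul _
  have hNs' : (Ns : ℂ) ≠ 0 := by exact_mod_cast hNs.ne'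
  rw [runsBefore, Finset.sum_product, Finset.sum_singleton, Finset.sum_product,
    Finset.sum_congr rfl fun n _ => hterm n, sum_range_dite_eq_sum_filter hm fun n =>
      (filteredData F ω i n - ∫ s, sampleValue F s ∂(sampleLaw H ψ F (((n : ℕ) : ℝ) * τ i)))
        * phase (((n : ℕ) : ℝ) * (x * τ i + y)), Finset.mul_sum]
  refine Finset.sum_congr rfl fun n _ => ?_
  simp only [integral_mul_const, filteredData, Finset.sum_sub_distrib, ← Finset.sum_mul,
    Finset.sum_const, Finset.card_univ, Fintype.card_fin, nsmul_eq_mul]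
  field_simp

lemma IsEigensystem.isProbabilityMeasure_outcomesLaw (h : IsEigensystem H v lam)
    (hψ : ‖ψ‖ = 1) (hF : 0 < filterNorm F) (τ : ℕ → ℝ) :
    IsProbabilityMeasure (outcomesLaw H ψ F J N Ns τ) := by
  have := h.isProbabilityMeasure_sampleLaw hψ hF
  unfold outcomesLaw
  infer_instance

lemma IsEigensystem.measureReal_lt_norm_sum_noise_le (h : IsEigensystem H v lam)
    (hψ : ‖ψ‖ = 1) (hF : 0 < filterNorm F) (hN : 0 < N) (hNs : 0 < Ns) (τ : ℕ → ℝ) (x y : ℝ)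
    (i : Fin J) {m : ℕ} (hm : m ≤ N) {σ : ℝ} (hσ : 0 < σ) :
    (outcomesLaw H ψ F J N Ns τ).real
      {ω | N * σ < ‖∑ n ∈ Finset.range m, noise H ψ F τ x ω i n * phase (n * y)‖}
      ≤ 4 * Real.exp (-((N : ℝ) * Ns * σ ^ 2 / (32 * filterNorm F ^ 2))) := by
  have := h.isProbabilityMeasure_sampleLaw hψ hF
  have hNs' : (0 : ℝ) < Ns := by exact_mod_cast hNs
  have hconc := measureReal_lt_norm_sum_sub_integral
    (μ := fun a : Fin J × Fin N × Fin Ns => sampleLaw H ψ F (((a.2.1 : ℕ) : ℝ) * τ a.1))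
    (g := fun a s => sampleValue F s * phase (((a.2.1 : ℕ) : ℝ) * (x * τ a.1 + y)))
    (fun a => measurable_of_finite _) (B := 2 * filterNorm F) (t := Ns * (N * σ)) (by positivity)
    (fun a s => by rw [norm_mul, norm_phase, mul_one]; exact norm_sampleValue_le F s)
    (by positivity) (runsBefore i m) (card_runsBefore_le i m)
  have hexp : -((Ns : ℝ) * (N * σ)) ^ 2 / (8 * (((N * Ns : ℕ) : ℝ) * (2 * filterNorm F) ^ 2))
      = -((N : ℝ) * Ns * σ ^ 2 / (32 * filterNorm F ^ 2)) := by
    push_cast; field_simp; ring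
  rw [hexp] at hconc
  refine le_of_eq_of_le ?_ hconc
  simp only [← natCast_mul_sum_noise_mul_phase hNs H ψ τ x y i hm, norm_mul,
    Complex.norm_natCast, mul_lt_mul_iff_right₀ hNs', outcomesLaw]

lemma card_grid (N : ℕ) : (grid N).card = 10 * N + 1 := by
  rw [Int.card_Icc]; omega

lemma IsEigensystem.one_sub_le_measureReal_smallNoise (h : IsEigensystem H v lam)
    (hψ : ‖ψ‖ = 1) (hF : 0 < filterNorm F) (hN : 2 ≤ N) (hNs : 0 < Ns) (τ : ℕ → ℝ) (x : ℝ)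
    {σ : ℝ} (hσ : 0 < σ) :
    1 - 64 * J * N ^ 2 * Real.exp (-((N : ℝ) * Ns * σ ^ 2 / (32 * filterNorm F ^ 2)))
      ≤ (outcomesLaw H ψ F J N Ns τ).real {ω | ∀ i, SmallNoise N (noise H ψ F τ x ω i) σ} := by
  have := h.isProbabilityMeasure_outcomesLaw (J := J) (N := N) (Ns := Ns) hψ hF τ
  set P := outcomesLaw H ψ F J N Ns τ
  set e := Real.exp (-((N : ℝ) * Ns * σ ^ 2 / (32 * filterNorm F ^ 2)))
  set good := {ω : Outcomes d J N Ns | ∀ i, SmallNoise N (noise H ψ F τ x ω i) σ} with hgood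
  let events : Finset (Fin J × ℕ × ℤ) := Finset.univ ×ˢ (Finset.range (N + 1) ×ˢ grid N)
  have hsub : goodᶜ ⊆ ⋃ a ∈ events, {ω : Outcomes d J N Ns | N * σ < ‖∑ n ∈ Finset.range a.2.1,
      noise H ψ F τ x ω a.1 n * phase (n * ((a.2.2 : ℝ) / N))‖} := by
    intro ω hω
    simp only [hgood, SmallNoise, Set.mem_compl_iff, Set.mem_ofPred_eq, not_forall, not_le] at hω
    obtain ⟨i, m, hm, k, hk, hlt⟩ := hω
    simp only [Set.mem_iUnion]
    exact ⟨(i, m, k), by simp only [events, Finset.mem_product, Finset.mem_univ,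
      Finset.mem_range, Nat.lt_succ_of_le hm, hk, and_self], hlt⟩
  have hunion : P.real goodᶜ ≤ ∑ _a ∈ events, 4 * e := by
    refine (measureReal_mono hsub (measure_ne_top _ _)).trans
      ((measureReal_biUnion_finset_le _ _).trans
      (Finset.sum_le_sum fun a ha => ?_))
    simp only [events, Finset.mem_product, Finset.mem_range] at ha
    exact h.measureReal_lt_norm_sum_noise_le hψ hF (by omega) hNs τ x _ a.1 (by omega) hσ
  have hcard : (events.card : ℝ) ≤ J * (16 * N ^ 2) := by
    have : (N + 1) * (10 * N + 1) ≤ 16 * N ^ 2 := by nlinarith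
    rw [Finset.card_product, Finset.card_product, Finset.card_range, card_grid, Finset.card_univ,
      Fintype.card_fin]
    exact_mod_cast Nat.mul_le_mul_left J this
  rw [Finset.sum_const, nsmul_eq_mul, probReal_compl_eq_one_sub (Set.toFinite _).measurableSet]
    at hunion
  have : events.card * (4 * e) ≤ J * (16 * N ^ 2) * (4 * e) := by gcongr
  linarith

end Noise

section Success

variable {E : Type*} [NormedAddCommGroup E] [InnerProductSpace ℂ E] {M : ℕ} {H : E →L[ℂ] E}
  {v : OrthonormalBasis (Fin (M + 1)) ℂ E} {lam : Fin (M + 1) → ℝ} {ψ : E}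
  {d J N Ns : ℕ} {F : Freq d → ℂ} {I I' : Set ℝ} {q δ : ℝ}

lemma IsFilter.one_sub_le_norm_filterEval (hF : IsFilter F q I I') {x : ℝ} (hx : x ∈ I) :
    1 - q ≤ ‖filterEval F x‖ := by
  have := norm_sub_le_norm_add 1 (filterEval F x - 1)
  rw [add_sub_cancel, norm_one] at this
  linarith [hF.1 x hx]

lemma IsFilter.filterNorm_pos (hF : IsFilter F q I I') {x : ℝ} (hx : x ∈ I) (hq : q < 1) :
    0 < filterNorm F :=
  (sub_pos.2 hq).trans_le ((hF.one_sub_le_norm_filterEval hx).trans (norm_filterEval_le F x))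

lemma overlap_le_one (hψ : ‖ψ‖ = 1) (m : Fin (M + 1)) : overlap v ψ m ≤ 1 :=
  sum_overlap (v := v) hψ ▸
    Finset.single_le_sum (fun k _ => overlap_nonneg v ψ k) (Finset.mem_univ m)

lemma overlap_mul_sq_le_one (hψ : ‖ψ‖ = 1) (m : Fin (M + 1)) (hδ : 0 ≤ δ) (hδ₁ : δ ≤ 1) :
    overlap v ψ m * δ ^ 2 ≤ 1 :=
  mul_le_one₀ (overlap_le_one hψ m) (sq_nonneg δ) (pow_le_one₀ hδ hδ₁)

lemma norm_bias_le_mul_sq (hψ : ‖ψ‖ = 1) (hlam : ∀ m, lam m ∈ Set.Icc (-π) π)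
    (h₀ : 0 < overlap v ψ 0) (hI : lam 0 ∈ I) (hI' : lam 0 ∈ I') (hF : IsFilter F q I I')
    (hδ : 0 ≤ δ) (hδ₁ : δ ≤ 1) (hrel : 2000 * √(1 - relOverlap v lam ψ I I') ≤ δ)
    (hq : q ≤ 1 / 400000 * (overlap v ψ 0 * δ ^ 2)) (t : ℝ) :
    ‖bias v lam ψ F t‖ ≤ overlap v ψ 0 * δ ^ 2 / 200000 := by
  have hq₁ : q ≤ 1 := by
    linarith [overlap_mul_sq_le_one (v := v) hψ 0 hδ hδ₁]
  have hρ : 1 - relOverlap v lam ψ I I' ≤ (δ / 2000) ^ 2 :=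
    (Real.sqrt_le_left (by positivity)).1 (by linarith)
  have := mul_nonneg (sq_nonneg δ) h₀.le
  calc ‖bias v lam ψ F t‖ ≤ (1 + q) * (2 * (δ / 2000) ^ 2 * overlap v ψ 0) + q :=
        norm_bias_le hψ hlam h₀ hI hI' hF hρ (by nlinarith) t
    _ ≤ (1 + 1) * (2 * (δ / 2000) ^ 2 * overlap v ψ 0)
          + 1 / 400000 * (overlap v ψ 0 * δ ^ 2) := by gcongr
    _ ≤ overlap v ψ 0 * δ ^ 2 / 200000 := by linarith

lemma IsEigensystem.filteredData_mul_phase (h : IsEigensystem H v lam) (hψ : ‖ψ‖ = 1)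
    (hF : 0 < filterNorm F) (τ : ℕ → ℝ) (ω : Outcomes d J N Ns) (i : Fin J) (n : Fin N) :
    filteredData F ω i n * phase ((n : ℕ) * (lam 0 * τ i))
      = overlap v ψ 0 * filterEval F (lam 0)
        + bias v lam ψ F ((n : ℕ) * τ i) * phase ((n : ℕ) * (lam 0 * τ i))
        + noise H ψ F τ (lam 0) ω i n := by
  have hcancel : phase (-((n : ℕ) * τ i * lam 0)) * phase ((n : ℕ) * (lam 0 * τ i)) = 1 := by
    rw [← phase_add, ← phase_zero]; congr 1; ring
  simp only [noise, Fin.is_lt, dif_pos, Fin.eta]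
  rw [sub_mul, h.integral_sampleValue_eq_add_bias hψ hF]
  linear_combination (overlap v ψ 0 : ℂ) * filterEval F (lam 0) * hcancel

lemma IsEigensystem.mem_successEvent (h : IsEigensystem H v lam) (hψ : ‖ψ‖ = 1)
    (hlam : lam 0 ∈ Set.Icc (-π) π) (h₀ : 0 < overlap v ψ 0)
    (hF : 0 < filterNorm F) (hF₀ : 3 / 4 ≤ ‖filterEval F (lam 0)‖) {ε : ℝ} (hε : 0 < ε)
    (hδ : 0 < δ) (hδ₁ : δ ≤ 1) (hN : 2 ≤ N)
    (hbias : ∀ t, ‖bias v lam ψ F t‖ ≤ overlap v ψ 0 * δ ^ 2 / 200000)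
    {ω : Outcomes d (numLevels ε) N Ns}
    (hω : ∀ i, SmallNoise N (noise H ψ F (timeStep ε δ N) (lam 0) ω i)
      (overlap v ψ 0 * δ / 600000)) :
    ω ∈ successEvent F (timeStep ε δ N) (lam 0) ε := by
  have hN₀ : 0 < N := by omega
  have hτ := timeStep_pos hε hδ hN₀
  have hτ₀ : timeStep ε δ N 0 ≤ 1 / 2 :=
    calc timeStep ε δ N 0 ≤ δ / N := timeStep_zero_le hε hδ.le
      _ ≤ 1 / 2 := by gcongr; exact_mod_cast hN
  intro r θ hrun
  have hlast : |θ (numLevels ε - 1) - lam 0| * (N * timeStep ε δ N (numLevels ε - 1)) < δ := by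
    refine hrun.abs_sub_lt hN hτ (timeStep_succ ε δ N) hτ₀ hlam hδ₁ (fun i r θ hmin hθ => ?_) _
      (by simp [numLevels])
    refine abs_sub_lt_of_minimizer (b := fun n => bias v lam ψ F ((n : ℝ) * timeStep ε δ N i) *
      phase ((n : ℝ) * (lam 0 * timeStep ε δ N i))) hN (hτ i) hδ hδ₁ h₀ ?_
      (h.filteredData_mul_phase hψ hF _ ω i) (fun n _ => ?_) le_rfl (hω i) le_rfl hmin hθ
    · rw [norm_mul, Complex.norm_real, Real.norm_of_nonneg h₀.le, mul_comm]
      gcongr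
    · rw [norm_mul, norm_phase, mul_one]
      exact hbias _
  rw [mul_timeStep_last hN₀, mul_div_assoc', div_lt_iff₀ hε, mul_comm δ] at hlast
  exact lt_of_mul_lt_mul_right hlast hδ.le

lemma IsEigensystem.one_sub_le_measureReal_successEvent (h : IsEigensystem H v lam)
    (hψ : ‖ψ‖ = 1) (hlam : ∀ m, lam m ∈ Set.Icc (-π) π) (h₀ : 0 < overlap v ψ 0)
    (hI : lam 0 ∈ I) (hI' : lam 0 ∈ I') (hF : IsFilter F q I I') (hδ : 0 < δ) (hδ₁ : δ ≤ 1)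
    (hrel : 2000 * √(1 - relOverlap v lam ψ I I') ≤ δ)
    (hq : q ≤ 1 / 400000 * (overlap v ψ 0 * δ ^ 2)) {ε : ℝ} (hε : 0 < ε) (hN : 2 ≤ N)
    (hNs : 0 < Ns) :
    1 - 64 * numLevels ε * N ^ 2 * Real.exp (-((N : ℝ) * Ns *
        (overlap v ψ 0 * δ / 600000) ^ 2 / (32 * filterNorm F ^ 2)))
      ≤ (outcomesLaw H ψ F (numLevels ε) N Ns (timeStep ε δ N)).real
          (successEvent F (timeStep ε δ N) (lam 0) ε) := by
  have hq_small : q ≤ 1 / 4 := by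
    linarith [overlap_mul_sq_le_one (v := v) hψ 0 hδ.le hδ₁]
  have hF_pos := hF.filterNorm_pos hI (by linarith)
  have := h.isProbabilityMeasure_outcomesLaw (J := numLevels ε) (N := N) (Ns := Ns) hψ hF_pos
    (timeStep ε δ N)
  have hbias := norm_bias_le_mul_sq hψ hlam h₀ hI hI' hF hδ.le hδ₁ hrel hq
  exact (h.one_sub_le_measureReal_smallNoise hψ hF_pos hN hNs _ (lam 0) (by positivity)).trans
    (measureReal_mono fun ω hω => h.mem_successEvent hψ (hlam 0) h₀ hF_pos
      (by linarith [hF.one_sub_le_norm_filterEval hI]) hε hδ hδ₁ hN hbias hω)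

end Success

section Logarithms

/-- `log (e + x)`, the base of `polylog`; adding `e` makes it at least `1` for `0 ≤ x`. -/
def logE (x : ℝ) : ℝ := Real.log (Real.exp 1 + x)

lemma one_le_logE {x : ℝ} (hx : 0 ≤ x) : 1 ≤ logE x :=
  (Real.le_log_iff_exp_le (by positivity)).2 (le_add_of_nonneg_right hx)

lemma logE_mono {x y : ℝ} (hx : 0 ≤ x) (h : x ≤ y) : logE x ≤ logE y :=
  Real.log_le_log (by positivity) (by linarith)

lemma log_le_logE {x : ℝ} (hx : 0 < x) : Real.log x ≤ logE x :=
  Real.log_le_log hx (le_add_of_nonneg_left (Real.exp_pos 1).le)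

lemma logE_mul_le {x y : ℝ} (hx : 0 ≤ x) (hy : 0 ≤ y) : logE (x * y) ≤ logE x + logE y := by
  have he : 1 ≤ Real.exp 1 := Real.one_le_exp zero_le_one
  rw [logE, logE, logE, ← Real.log_mul (by positivity) (by positivity)]
  refine Real.log_le_log (by positivity) ?_
  calc Real.exp 1 + x * y ≤ Real.exp 1 * Real.exp 1 + x * y := by
        gcongr; exact le_mul_of_one_le_left (by positivity) he
    _ ≤ Real.exp 1 * Real.exp 1 + x * y + (Real.exp 1 * y + x * Real.exp 1) :=
        le_add_of_nonneg_right (by positivity)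
    _ = (Real.exp 1 + x) * (Real.exp 1 + y) := by ring

lemma logE_pow_le {x : ℝ} (hx : 0 ≤ x) {k : ℕ} (hk : k ≠ 0) : logE (x ^ k) ≤ k * logE x := by
  rw [logE, logE, ← Real.log_pow]
  refine Real.log_le_log (by positivity) ?_
  calc Real.exp 1 + x ^ k ≤ Real.exp 1 ^ k + x ^ k := by
        gcongr; exact le_self_pow₀ (Real.one_le_exp zero_le_one) hk
    _ ≤ (Real.exp 1 + x) ^ k := pow_add_pow_le (by positivity) hx hk

lemma logE_le_one_add {x : ℝ} (hx : 0 ≤ x) : logE x ≤ 1 + x := by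
  have he : 1 ≤ Real.exp 1 := Real.one_le_exp zero_le_one
  calc logE x ≤ Real.log (Real.exp 1 * (1 + x)) := Real.log_le_log (by positivity) (by nlinarith)
    _ = 1 + Real.log (1 + x) := by rw [Real.log_mul (by positivity) (by positivity), Real.log_exp]
    _ ≤ 1 + x := by linarith [Real.log_le_sub_one_of_pos (by positivity : 0 < 1 + x)]

lemma logE_le_rpow_div {x r : ℝ} (hx : 1 ≤ x) (hr : 0 < r) : logE x ≤ (4 * x) ^ r / r :=
  (Real.log_le_log (by positivity) (by linarith [Real.exp_one_lt_d9])).trans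
    (Real.log_le_rpow_div (by positivity) hr)

lemma logE_le_sqrt {x : ℝ} (hx : 1 ≤ x) : logE x ≤ 4 * √x := by
  have h₄ : √4 = 2 := by rw [show (4 : ℝ) = 2 ^ 2 by norm_num, Real.sqrt_sq zero_le_two]
  have := logE_le_rpow_div hx one_half_pos
  rw [← Real.sqrt_eq_rpow, Real.sqrt_mul zero_le_four, h₄] at this
  linarith

lemma logE_inv_cube_le {ζ δ : ℝ} (hζ : 0 < ζ) (hδ : 0 < δ) (hδ₁ : δ ≤ 1) :
    logE δ⁻¹ ^ 3 ≤ (3 / ζ) ^ 3 * 4 ^ ζ * δ ^ (-ζ) := by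
  have hinv := (one_le_inv₀ hδ).2 hδ₁
  calc logE δ⁻¹ ^ 3 ≤ ((4 * δ⁻¹) ^ (ζ / 3) / (ζ / 3)) ^ 3 := by
        gcongr
        · exact zero_le_one.trans (one_le_logE (by positivity))
        · exact logE_le_rpow_div hinv (by positivity)
    _ = (3 / ζ) ^ 3 * (4 * δ⁻¹) ^ ζ := by
        rw [div_pow, ← Real.rpow_natCast ((4 * δ⁻¹) ^ (ζ / 3)), ← Real.rpow_mul (by positivity),
          Nat.cast_ofNat, div_mul_cancel₀ ζ three_ne_zero, div_eq_mul_inv, ← inv_pow, inv_div,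
          mul_comm]
    _ = (3 / ζ) ^ 3 * 4 ^ ζ * δ ^ (-ζ) := by
        rw [Real.mul_rpow zero_le_four (by positivity), Real.inv_rpow hδ.le, Real.rpow_neg hδ.le,
          mul_assoc]

end Logarithms

section SampleSize

variable {ζ ε η p δ D : ℝ}

/-- The logarithm `L` in the sample bound `X = p₀⁻² δ^{-(2+ζ)} L ^ k`. -/
def logScale (ζ ε η p D : ℝ) : ℝ :=
  logE (Real.log ζ⁻¹ * Real.log ε⁻¹ * D⁻¹ * η⁻¹ * p⁻¹)

lemma sampleBound_eq (hδ : 0 < δ) (k : ℕ) : sampleBound k ζ ε η p δ D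
    = (p ^ 2)⁻¹ * (δ ^ 2)⁻¹ * δ ^ (-ζ) * logScale ζ ε η p D ^ k := by
  rw [sampleBound, neg_add, Real.rpow_add hδ, Real.rpow_neg hδ.le 2, Real.rpow_two, polylog,
    logScale, logE, ← mul_assoc]

lemma log_inv_pos (hζ : 0 < ζ) (hζ₁ : ζ < 1) : 0 < Real.log ζ⁻¹ :=
  Real.log_pos ((one_lt_inv₀ hζ).2 hζ₁)

lemma one_le_logScale (hζ : 0 < ζ) (hζ₁ : ζ < 1) (hε : 0 < ε) (hε₁ : ε < 1) (hη : 0 ≤ η)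
    (hp : 0 ≤ p) (hD : 0 ≤ D) : 1 ≤ logScale ζ ε η p D := by
  have := log_inv_pos hζ hζ₁
  have := log_inv_pos hε hε₁
  exact one_le_logE (by positivity)

lemma sampleBound_pos (hζ : 0 < ζ) (hζ₁ : ζ < 1) (hε : 0 < ε) (hε₁ : ε < 1) (hη : 0 ≤ η)
    (hp : 0 < p) (hD : 0 ≤ D) (hδ : 0 < δ) (k : ℕ) : 0 < sampleBound k ζ ε η p δ D := by
  have := one_le_logScale hζ hζ₁ hε hε₁ hη hp.le hD
  rw [sampleBound_eq hδ]
  positivity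

lemma log_two_le_log_inv (hε : 0 < ε) (hε₁ : ε ≤ 1 / 2) : Real.log 2 ≤ Real.log ε⁻¹ :=
  Real.log_le_log zero_lt_two ((le_inv_comm₀ zero_lt_two hε).2 (by linarith))

lemma numLevels_le (hε : 0 < ε) (hε₁ : ε ≤ 1 / 2) : (numLevels ε : ℝ) ≤ 6 * Real.log ε⁻¹ := by
  have hlog_two := Real.log_two_gt_d9
  have hlog_inv := log_two_le_log_inv hε hε₁
  have hceil : (⌈Real.logb 2 (1 / ε)⌉₊ : ℝ) < Real.logb 2 (1 / ε) + 1 :=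
    Nat.ceil_lt_add_one (Real.logb_nonneg one_lt_two ((le_div_iff₀ hε).2 (by linarith)))
  have hlogb : Real.logb 2 (1 / ε) ≤ 2 * Real.log ε⁻¹ := by
    rw [Real.logb, one_div, div_le_iff₀ (by linarith)]
    nlinarith
  rw [numLevels, Nat.cast_add, Nat.cast_one]
  linarith

lemma logE_le_mul_logScale (hζ : 0 < ζ) (hζ₁ : ζ < 1) {x : ℝ} (hx : 0 ≤ x)
    (h : x ≤ 100 * (Real.log ε⁻¹ * D⁻¹ * η⁻¹ * p⁻¹)) :
    logE x ≤ 2 * logE (100 / Real.log ζ⁻¹) * logScale ζ ε η p D := by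
  have hlog := log_inv_pos hζ hζ₁
  have hscale : Real.log ζ⁻¹ * Real.log ε⁻¹ * D⁻¹ * η⁻¹ * p⁻¹
      = Real.log ζ⁻¹ * (Real.log ε⁻¹ * D⁻¹ * η⁻¹ * p⁻¹) := by ring
  have hnonneg : 0 ≤ Real.log ε⁻¹ * D⁻¹ * η⁻¹ * p⁻¹ := by linarith
  rw [logScale, hscale]
  generalize Real.log ε⁻¹ * D⁻¹ * η⁻¹ * p⁻¹ = y at *
  have hL := one_le_logE (mul_nonneg hlog.le hnonneg)
  have hm := one_le_logE (div_nonneg (by norm_num : (0 : ℝ) ≤ 100) hlog.le)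
  calc logE x ≤ logE (100 / Real.log ζ⁻¹ * (Real.log ζ⁻¹ * y)) :=
        logE_mono hx (h.trans_eq (by rw [← mul_assoc, div_mul_cancel₀ _ hlog.ne']))
    _ ≤ logE (100 / Real.log ζ⁻¹) + logE (Real.log ζ⁻¹ * y) :=
        logE_mul_le (by positivity) (by positivity)
    _ ≤ 2 * logE (100 / Real.log ζ⁻¹) * logE (Real.log ζ⁻¹ * y) := by nlinarith

lemma logE_inv_le_mul_logScale (hζ : 0 < ζ) (hζ₁ : ζ < 1) (hε : 0 < ε) (hε₁ : ε ≤ 1 / 2)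
    (hη : 0 < η) (hη₁ : η ≤ 1) (hp : 0 < p) (hp₁ : p ≤ 1) (hD : 0 < D) (hD₈ : D ≤ 8) :
    let C := 2 * logE (100 / Real.log ζ⁻¹)
    logE p⁻¹ ≤ C * logScale ζ ε η p D ∧ logE D⁻¹ ≤ C * logScale ζ ε η p D ∧
      logE (numLevels ε * η⁻¹) ≤ C * logScale ζ ε η p D := by
  have hlog : 1 / 2 ≤ Real.log ε⁻¹ := by
    linarith [log_two_le_log_inv hε hε₁, Real.log_two_gt_d9]
  have hD_inv : 1 / 8 ≤ D⁻¹ := by rw [one_div]; exact inv_anti₀ hD hD₈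
  have hη_inv := (one_le_inv₀ hη).2 hη₁
  have hp_inv := (one_le_inv₀ hp).2 hp₁
  refine ⟨logE_le_mul_logScale hζ hζ₁ (by positivity) ?_,
    logE_le_mul_logScale hζ hζ₁ (by positivity) ?_,
    logE_le_mul_logScale hζ hζ₁ (by positivity) ?_⟩
  · calc p⁻¹ ≤ 100 * (1 / 2 * (1 / 8) * 1 * p⁻¹) := by linarith
      _ ≤ 100 * (Real.log ε⁻¹ * D⁻¹ * η⁻¹ * p⁻¹) := by gcongr
  · calc D⁻¹ ≤ 100 * (1 / 2 * D⁻¹ * 1 * 1) := by linarith [inv_pos.2 hD]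
      _ ≤ 100 * (Real.log ε⁻¹ * D⁻¹ * η⁻¹ * p⁻¹) := by gcongr
  · calc numLevels ε * η⁻¹ ≤ 6 * Real.log ε⁻¹ * η⁻¹ := by gcongr; exact numLevels_le hε hε₁
      _ ≤ 100 * (Real.log ε⁻¹ * (1 / 8) * η⁻¹ * 1) := by
        linarith [mul_nonneg (one_half_pos.le.trans hlog) (inv_pos.2 hη).le]
      _ ≤ 100 * (Real.log ε⁻¹ * D⁻¹ * η⁻¹ * p⁻¹) := by gcongr

lemma logE_le_of_le_mul_logE {A x y n : ℝ} (hA : 0 ≤ A) (hx : 0 ≤ x) (hy : 0 ≤ y) (hn : 0 ≤ n)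
    (h : n ≤ A * (x * logE y)) : logE n ≤ logE A + logE x + 2 * logE y := by
  have hlog := one_le_logE hy
  calc logE n ≤ logE (A * (x * logE y)) := logE_mono hn h
    _ ≤ logE A + logE (x * logE y) := logE_mul_le hA (by positivity)
    _ ≤ logE A + (logE x + logE (logE y)) := by gcongr; exact logE_mul_le hx (by positivity)
    _ ≤ logE A + logE x + 2 * logE y := by linarith [logE_le_one_add (zero_le_one.trans hlog)]

lemma logE_sampleBound_le (hζ : 0 < ζ) (hζ₁ : ζ < 1) (hε : 0 < ε) (hε₁ : ε < 1) (hη : 0 ≤ η)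
    (hp : 0 < p) (hD : 0 ≤ D) (hδ : 0 < δ) (hδ₁ : δ ≤ 1) : logE (sampleBound 3 ζ ε η p δ D)
      ≤ 2 * logE p⁻¹ + 3 * logE δ⁻¹ + 6 * logScale ζ ε η p D := by
  have hL := one_le_logScale hζ hζ₁ hε hε₁ hη hp.le hD
  have hX : sampleBound 3 ζ ε η p δ D ≤ p⁻¹ ^ 2 * (δ⁻¹ ^ 3 * logScale ζ ε η p D ^ 3) := by
    have hpow : δ ^ (-ζ) ≤ δ⁻¹ := by
      rw [← Real.rpow_neg_one]
      exact Real.rpow_le_rpow_of_exponent_ge hδ hδ₁ (by linarith)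
    rw [sampleBound_eq hδ, show p⁻¹ ^ 2 * (δ⁻¹ ^ 3 * logScale ζ ε η p D ^ 3)
      = (p ^ 2)⁻¹ * (δ ^ 2)⁻¹ * δ⁻¹ * logScale ζ ε η p D ^ 3 by ring]
    gcongr
  have hlogX := logE_mono (sampleBound_pos hζ hζ₁ hε hε₁ hη hp hD hδ 3).le hX
  have hmul₁ := logE_mul_le (x := p⁻¹ ^ 2) (y := δ⁻¹ ^ 3 * logScale ζ ε η p D ^ 3)
    (by positivity) (by positivity)
  have hmul₂ := logE_mul_le (x := δ⁻¹ ^ 3) (y := logScale ζ ε η p D ^ 3) (by positivity)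
    (by positivity)
  have hp_pow := logE_pow_le (inv_pos.2 hp).le two_ne_zero
  have hδ_pow := logE_pow_le (inv_pos.2 hδ).le three_ne_zero
  have hL_pow := logE_pow_le (zero_le_one.trans hL) three_ne_zero
  have hL_log := logE_le_one_add (zero_le_one.trans hL)
  push_cast at hp_pow hδ_pow hL_pow
  linarith

lemma log_mul_sq_div_le {R X : ℝ} {J N S : ℝ} (hJ : 0 < J) (hη : 0 < η) (hN : 0 < N) (hNS : N ≤ S)
    (hR : 1 ≤ R) (hX : 0 ≤ X) (hS : S = R * X) :
    Real.log (64 * J * N ^ 2 * η⁻¹)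
      ≤ logE 64 + logE (J * η⁻¹) + 8 * √R + 2 * logE X := by
  have hS_pos : 0 < S := hN.trans_le hNS
  have hlogS : logE S ≤ 4 * √R + logE X := hS ▸
    (logE_mul_le (zero_le_one.trans hR) hX).trans (by gcongr; exact logE_le_sqrt hR)
  calc Real.log (64 * J * N ^ 2 * η⁻¹) ≤ logE (64 * J * N ^ 2 * η⁻¹) := log_le_logE (by positivity)
    _ ≤ logE (64 * (J * η⁻¹ * S ^ 2)) := logE_mono (by positivity) <| calc
        64 * J * N ^ 2 * η⁻¹ = 64 * (J * η⁻¹ * N ^ 2) := by ring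
        _ ≤ 64 * (J * η⁻¹ * S ^ 2) := by gcongr
    _ ≤ logE 64 + (logE (J * η⁻¹) + 2 * logE S) :=
        (logE_mul_le (by norm_num) (by positivity)).trans <| by
          gcongr
          exact (logE_mul_le (by positivity) (by positivity)).trans
            (by gcongr; exact_mod_cast logE_pow_le hS_pos.le two_ne_zero)
    _ ≤ logE 64 + logE (J * η⁻¹) + 8 * √R + 2 * logE X := by linarith

lemma sq_mul_le_of_le_mul_sqrt {R L ℓ K K₁ K₂ G T z : ℝ} (hL : 0 ≤ L) (hℓ : 0 ≤ ℓ)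
    (hK₂ : 0 ≤ K₂) (hz : 0 ≤ z) (hG₀ : 0 ≤ G) (hG : G ≤ K₁ * (L * ℓ))
    (hT : T ≤ K₂ * (√R * (L * ℓ))) (hcube : ℓ ^ 3 ≤ K * z)
    (hR : (32 * K₁ ^ 2 * K₂ * K) ^ 2 ≤ R) : 32 * G ^ 2 * T ≤ R * z * L ^ 3 := by
  have hR₀ := (sq_nonneg _).trans hR
  calc 32 * G ^ 2 * T ≤ 32 * G ^ 2 * (K₂ * (√R * (L * ℓ))) := by gcongr
    _ ≤ 32 * (K₁ * (L * ℓ)) ^ 2 * (K₂ * (√R * (L * ℓ))) := by gcongr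
    _ = 32 * K₁ ^ 2 * K₂ * √R * L ^ 3 * ℓ ^ 3 := by ring
    _ ≤ 32 * K₁ ^ 2 * K₂ * √R * L ^ 3 * (K * z) := by gcongr
    _ = 32 * K₁ ^ 2 * K₂ * K * (√R * L ^ 3 * z) := by ring
    _ ≤ √R * (√R * L ^ 3 * z) := by gcongr; exact Real.le_sqrt_of_sq_le hR
    _ = √R * √R * z * L ^ 3 := by ring
    _ = R * z * L ^ 3 := by rw [Real.mul_self_sqrt hR₀]

lemma le_mul_logScale_mul_logE {A C n G : ℝ} (hA : 0 ≤ A) (hn : 0 ≤ n) (hp : 0 ≤ p) (hδ : 0 ≤ δ)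
    (hD : 0 ≤ D) (hL : 1 ≤ logScale ζ ε η p D) (hC : 0 ≤ C)
    (hlog_p : logE p⁻¹ ≤ C * logScale ζ ε η p D) (hlog_D : logE D⁻¹ ≤ C * logScale ζ ε η p D)
    (h : n ≤ A * (D⁻¹ * logE (p⁻¹ * δ⁻¹))) (hG : G ≤ A * logE n) :
    G ≤ A * (logE A + 3 * C + 2) * (logScale ζ ε η p D * logE δ⁻¹) := by
  have hlog_n := logE_le_of_le_mul_logE hA (by positivity) (by positivity) hn h
  have hmul := logE_mul_le (inv_nonneg.2 hp) (inv_nonneg.2 hδ)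
  have hlog_A := one_le_logE hA
  have hℓ : 1 ≤ logE δ⁻¹ := one_le_logE (by positivity)
  generalize logScale ζ ε η p D = L at *
  generalize logE δ⁻¹ = ℓ at *
  have hL_le : L ≤ L * ℓ := le_mul_of_one_le_right (by linarith) hℓ
  have hℓ_le : ℓ ≤ L * ℓ := le_mul_of_one_le_left (by linarith) hL
  calc G ≤ A * (logE A * 1 + 3 * (C * L) + 2 * ℓ) := hG.trans (by gcongr; linarith)
    _ ≤ A * (logE A * (L * ℓ) + 3 * (C * (L * ℓ)) + 2 * (L * ℓ)) := by
        gcongr; exact hL.trans hL_le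
    _ = A * (logE A + 3 * C + 2) * (L * ℓ) := by ring

lemma log_mul_sq_div_le_mul_logScale (hζ : 0 < ζ) (hζ₁ : ζ < 1) (hε : 0 < ε) (hε₁ : ε < 1)
    (hη : 0 < η) (hp : 0 < p) (hD : 0 ≤ D) (hδ : 0 < δ) (hδ₁ : δ ≤ 1) {C J N S : ℝ} (hC : 0 ≤ C)
    (hlog_p : logE p⁻¹ ≤ C * logScale ζ ε η p D)
    (hlog_J : logE (J * η⁻¹) ≤ C * logScale ζ ε η p D) (hJ : 0 < J) (hN : 0 < N) (hNS : N ≤ S)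
    (hS : sampleBound 3 ζ ε η p δ D ≤ S) :
    Real.log (64 * J * N ^ 2 * η⁻¹) ≤ (logE 64 + 5 * C + 26) *
      (√(S / sampleBound 3 ζ ε η p δ D) * (logScale ζ ε η p D * logE δ⁻¹)) := by
  have hX := sampleBound_pos hζ hζ₁ hε hε₁ hη.le hp hD hδ 3
  have hR := (one_le_div hX).2 hS
  have hlogQ := log_mul_sq_div_le hJ hη hN hNS hR hX.le (div_mul_cancel₀ S hX.ne').symm
  have hlogX := logE_sampleBound_le hζ hζ₁ hε hε₁ hη.le hp hD hδ hδ₁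
  have hL := one_le_logScale hζ hζ₁ hε hε₁ hη.le hp.le hD
  have hℓ : 1 ≤ logE δ⁻¹ := one_le_logE (by positivity)
  have h64 : 1 ≤ logE 64 := one_le_logE (by norm_num)
  have hr := Real.one_le_sqrt.2 hR
  generalize logScale ζ ε η p D = L at *
  generalize logE δ⁻¹ = ℓ at *
  generalize √(S / sampleBound 3 ζ ε η p δ D) = r at *
  have hL_le : L ≤ L * ℓ := le_mul_of_one_le_right (by linarith) hℓ
  have hℓ_le : ℓ ≤ L * ℓ := le_mul_of_one_le_left (by linarith) hL
  have hle : L * ℓ ≤ r * (L * ℓ) := le_mul_of_one_le_left (by positivity) hr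
  have hr_le : r ≤ r * (L * ℓ) := le_mul_of_one_le_right (by linarith) (hL.trans hL_le)
  have hconst : logE 64 * 1 ≤ logE 64 * (r * (L * ℓ)) := by gcongr; linarith
  have hCL : C * L ≤ C * (r * (L * ℓ)) := by gcongr; linarith
  linarith

lemma exists_sample_constant {A s : ℝ} (hA : 0 < A) (hζ : 0 < ζ) (hζ₁ : ζ < 1) (hs : s ≠ 0) :
    ∃ C > 0, ∀ {D p δ ε η G : ℝ} {d N Ns : ℕ}, 0 < D → D ≤ 8 → 0 < p → p ≤ 1 → 0 < δ → δ ≤ 1 →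
      0 < ε → ε < 1 / 2 → 0 < η → η ≤ 1 → (d : ℝ) ≤ A * (D⁻¹ * polylog 1 (p⁻¹ * δ⁻¹)) →
      0 < G → G ≤ A * logE d → 0 < N → 0 < Ns →
      C * sampleBound 3 ζ ε η p δ D ≤ (N : ℝ) * Ns →
      64 * (numLevels ε) * N ^ 2 *
        Real.exp (-((N : ℝ) * Ns * (p * δ * s) ^ 2 / (32 * G ^ 2))) ≤ η := by
  set C₀ := 2 * logE (100 / Real.log ζ⁻¹)
  set K₁ := A * (logE A + 3 * C₀ + 2)
  set K₂ := logE 64 + 5 * C₀ + 26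
  set K := (3 / ζ) ^ 3 * 4 ^ ζ / s ^ 2 with hK
  have hC₀ : 0 ≤ C₀ := by
    linarith [one_le_logE (div_nonneg (by norm_num : (0 : ℝ) ≤ 100) (log_inv_pos hζ hζ₁).le)]
  have hK₂ : 0 ≤ K₂ := by linarith [one_le_logE (by norm_num : (0 : ℝ) ≤ 64)]
  refine ⟨1 + (32 * K₁ ^ 2 * K₂ * K) ^ 2, by positivity, ?_⟩
  intro D p δ ε η G d N Ns hD hD₈ hp hp₁ hδ hδ₁ hε hε₁ hη hη₁ hd hG₀ hG hN hNs hS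
  have hε_one : ε < 1 := by linarith
  have hX := sampleBound_pos hζ hζ₁ hε hε_one hη.le hp hD.le hδ 3
  have hL := one_le_logScale hζ hζ₁ hε hε_one hη.le hp.le hD.le
  have hℓ : 1 ≤ logE δ⁻¹ := one_le_logE (by positivity)
  have hJ : (0 : ℝ) < numLevels ε := by exact_mod_cast Nat.succ_pos _
  obtain ⟨hlog_p, hlog_D, hlog_J⟩ := logE_inv_le_mul_logScale hζ hζ₁ hε hε₁.le hη hη₁ hp hp₁ hD hD₈
  rw [polylog, pow_one] at hd
  have hQ := log_mul_sq_div_le_mul_logScale hζ hζ₁ hε hε_one hη hp hD.le hδ hδ₁ hC₀ hlog_p hlog_J hJ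
    (Nat.cast_pos.2 hN) (le_mul_of_one_le_right (Nat.cast_nonneg N) (by exact_mod_cast hNs))
    ((le_mul_of_one_le_left hX.le (by linarith [sq_nonneg (32 * K₁ ^ 2 * K₂ * K)])).trans hS)
  have hcube : logE δ⁻¹ ^ 3 ≤ K * (s ^ 2 * δ ^ (-ζ)) :=
    (logE_inv_cube_le hζ hδ hδ₁).trans_eq (by rw [hK]; field_simp)
  have hexponent := sq_mul_le_of_le_mul_sqrt (zero_le_one.trans hL) (zero_le_one.trans hℓ) hK₂
    (by positivity) hG₀.le (le_mul_logScale_mul_logE hA.le (Nat.cast_nonneg d) hp.le hδ.le hD.le hL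
      hC₀ hlog_p hlog_D hd hG) hQ hcube
    ((le_add_of_nonneg_left zero_le_one).trans ((le_div_iff₀ hX).2 hS))
  have hscale : N * Ns * (p * δ * s) ^ 2 = N * Ns / sampleBound 3 ζ ε η p δ D
      * (s ^ 2 * δ ^ (-ζ)) * logScale ζ ε η p D ^ 3 := by
    rw [div_mul_eq_mul_div, div_mul_eq_mul_div, eq_div_iff hX.ne', sampleBound_eq hδ]
    field_simp
  calc 64 * (numLevels ε) * N ^ 2 * Real.exp (-((N : ℝ) * Ns * (p * δ * s) ^ 2 / (32 * G ^ 2)))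
      ≤ 64 * (numLevels ε) * N ^ 2 * Real.exp (-Real.log (64 * numLevels ε * N ^ 2 * η⁻¹)) := by
        gcongr
        rw [le_div_iff₀ (by positivity), mul_comm, hscale]
        exact hexponent
    _ = η := by
        rw [Real.exp_neg, Real.exp_log (by positivity)]
        field_simp

end SampleSize

section TrigPoly

/-- The trigonometric polynomials of degree at most `d`. The frequencies carry a minus sign so that
the coefficients of a member form a filter in the sense of `filterEval`. -/
def trigPoly (d : ℕ) : Submodule ℂ (ℝ → ℂ) :=
  Submodule.span ℂ (Set.range fun (l : Freq d) (x : ℝ) => phase (-((l : ℤ) * x)))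

lemma mem_trigPoly_iff {d : ℕ} {f : ℝ → ℂ} :
    f ∈ trigPoly d ↔ ∃ F : Freq d → ℂ, filterEval F = f := by
  rw [trigPoly, Submodule.mem_span_range_iff_exists_fun]
  refine exists_congr fun F => Eq.congr_left ?_
  funext x
  rw [filterEval_eq_sum_phase, Finset.sum_apply]
  rfl

lemma phase_mem_trigPoly {d : ℕ} {l : ℤ} (hl : |l| ≤ d) :
    (fun x : ℝ => phase (l * x)) ∈ trigPoly d := by
  refine Submodule.subset_span ⟨⟨-l, Finset.mem_Icc.2 (abs_le.1 (by rwa [abs_neg]))⟩, ?_⟩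
  funext x
  simp only [Int.cast_neg, neg_mul, neg_neg]

lemma trigPoly_mono {d e : ℕ} (h : d ≤ e) : trigPoly d ≤ trigPoly e := by
  refine Submodule.span_mono ?_
  rintro _ ⟨l, rfl⟩
  exact ⟨⟨l, Finset.Icc_subset_Icc (by lia) (by lia) l.2⟩, rfl⟩

lemma mul_mem_trigPoly {d e : ℕ} {f g : ℝ → ℂ} (hf : f ∈ trigPoly d) (hg : g ∈ trigPoly e) :
    f * g ∈ trigPoly (d + e) := by
  suffices h : trigPoly d * trigPoly e ≤ trigPoly (d + e) from h (Submodule.mul_mem_mul hf hg)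
  rw [trigPoly, trigPoly, Submodule.span_mul_span, Submodule.span_le]
  rintro _ ⟨_, ⟨l, rfl⟩, _, ⟨k, rfl⟩, rfl⟩
  change (fun x : ℝ => phase (-((l : ℤ) * x)) * phase (-((k : ℤ) * x))) ∈ trigPoly (d + e)
  convert phase_mem_trigPoly (d := d + e) (l := -(l + k : ℤ)) ?_ using 1
  · funext x
    rw [← phase_add]
    push_cast
    ring_nf
  · have hl := Finset.mem_Icc.1 l.2
    have hk := Finset.mem_Icc.1 k.2
    rw [abs_le]
    push_cast
    lia

lemma pow_mem_trigPoly {d : ℕ} {f : ℝ → ℂ} (hf : f ∈ trigPoly d) (r : ℕ) :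
    f ^ r ∈ trigPoly (r * d) := by
  induction r with
  | zero =>
    convert phase_mem_trigPoly (d := 0 * d) (l := 0) (by simp) using 1
    funext x
    simp
  | succ r ih =>
    rw [pow_succ, Nat.succ_mul]
    exact mul_mem_trigPoly ih hf

lemma phase_intCast_mul_add_two_pi (n : ℤ) (x : ℝ) : phase (n * (x + 2 * π)) = phase (n * x) := by
  have h : phase (n * (2 * π)) = 1 := by
    rw [phase, Complex.exp_eq_one_iff]
    exact ⟨n, by push_cast; ring⟩
  rw [mul_add, phase_add, h, mul_one]

lemma intervalIntegrable_mul_phase (n : ℤ) (c : ℂ) (a b : ℝ) :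
    IntervalIntegrable (fun x => c * phase (n * x)) volume a b :=
  Continuous.intervalIntegrable (by fun_prop) a b

lemma integral_phase_intCast_mul {n : ℤ} (hn : n ≠ 0) (a b : ℝ) :
    ∫ x in a..b, phase (n * x) = (phase (n * b) - phase (n * a)) / (Complex.I * n) := by
  have hphase : ∀ x : ℝ, phase (n * x) = Complex.exp (Complex.I * n * x) := fun x => by
    rw [phase, Complex.ofReal_mul, Complex.ofReal_intCast, mul_assoc]
  simp only [hphase]
  exact integral_exp_mul_complex (mul_ne_zero Complex.I_ne_zero (Int.cast_ne_zero.2 hn))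

lemma norm_integral_phase_intCast_mul_le {n : ℤ} (hn : n ≠ 0) (a b : ℝ) :
    ‖∫ x in a..b, phase (n * x)‖ ≤ 2 / |(n : ℝ)| := by
  rw [integral_phase_intCast_mul hn, norm_div, norm_mul, Complex.norm_I, one_mul,
    Complex.norm_intCast]
  gcongr
  refine (norm_sub_le _ _).trans ?_
  rw [norm_phase, norm_phase, one_add_one_eq_two]

lemma integral_phase_period (n : ℤ) :
    ∫ x in -π..π, phase (n * x) = if n = 0 then 2 * (π : ℂ) else 0 := by
  split_ifs with hn
  · simp only [hn, Int.cast_zero, zero_mul, phase_zero, intervalIntegral.integral_const,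
      Complex.real_smul]
    push_cast
    ring
  · have h := phase_intCast_mul_add_two_pi n (-π)
    rw [show -π + 2 * π = π by ring] at h
    rw [integral_phase_intCast_mul hn, h, sub_self, zero_div]

section Orthogonality

variable {ι : Type*} {s : Finset ι} {ν : ι → ℤ}

lemma integral_sum_mul_phase (hν : Set.InjOn ν s) (c : ι → ℂ) {k : ι} (hk : k ∈ s) :
    ∫ x in -π..π, (∑ i ∈ s, c i * phase (ν i * x)) * phase (-(ν k * x)) = 2 * π * c k := by
  have hexpand : ∀ x : ℝ, (∑ i ∈ s, c i * phase (ν i * x)) * phase (-(ν k * x))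
      = ∑ i ∈ s, c i * phase ((ν i - ν k : ℤ) * x) := fun x => by
    rw [Finset.sum_mul]
    refine Finset.sum_congr rfl fun i _ => ?_
    rw [mul_assoc, ← phase_add]
    push_cast
    ring_nf
  simp only [hexpand]
  rw [intervalIntegral.integral_finsetSum fun i _ => intervalIntegrable_mul_phase _ _ _ _,
    Finset.sum_eq_single_of_mem k hk]
  · rw [intervalIntegral.integral_const_mul, integral_phase_period, if_pos (sub_self _), mul_comm]
  · intro i hi hik
    rw [intervalIntegral.integral_const_mul, integral_phase_period,
      if_neg (sub_ne_zero.2 fun h => hik (hν hi hk h)), mul_zero]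

lemma integral_norm_sum_phase_sq (hν : Set.InjOn ν s) (c : ι → ℂ) :
    ∫ x in -π..π, ‖∑ i ∈ s, c i * phase (ν i * x)‖ ^ 2 = 2 * π * ∑ i ∈ s, ‖c i‖ ^ 2 := by
  have hexpand : ∀ x : ℝ, ((‖∑ i ∈ s, c i * phase (ν i * x)‖ ^ 2 : ℝ) : ℂ)
      = ∑ k ∈ s, conj (c k) * ((∑ i ∈ s, c i * phase (ν i * x)) * phase (-(ν k * x))) := fun x => by
    rw [← Complex.normSq_eq_norm_sq, ← Complex.mul_conj, map_sum, Finset.mul_sum]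
    refine Finset.sum_congr rfl fun k _ => ?_
    rw [map_mul, conj_phase]
    ring
  rw [← Complex.ofReal_inj, ← intervalIntegral.integral_ofReal]
  simp only [hexpand]
  rw [intervalIntegral.integral_finsetSum fun k _ =>
    Continuous.intervalIntegrable (by fun_prop) _ _]
  push_cast
  rw [Finset.mul_sum]
  refine Finset.sum_congr rfl fun k hk => ?_
  rw [intervalIntegral.integral_const_mul, integral_sum_mul_phase hν c hk, ← Complex.mul_conj']
  ring

end Orthogonality

lemma two_pi_mul_norm_le_integral_norm_filterEval {d : ℕ} (F : Freq d → ℂ) (k : Freq d) :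
    2 * π * ‖F k‖ ≤ ∫ x in -π..π, ‖filterEval F x‖ := by
  have hcoeff : ∫ x in -π..π, filterEval F x * phase ((k : ℤ) * x) = 2 * π * F k := by
    have h := integral_sum_mul_phase (s := Finset.univ) (ν := fun l : Freq d => -(l : ℤ))
      (fun l _ m _ h => Subtype.ext (neg_injective h)) F (Finset.mem_univ k)
    simpa only [filterEval_eq_sum_phase, Int.cast_neg, neg_mul, neg_neg] using h
  calc 2 * π * ‖F k‖ = ‖∫ x in -π..π, filterEval F x * phase ((k : ℤ) * x)‖ := by
        rw [hcoeff, norm_mul, norm_mul, Complex.norm_real, Complex.norm_ofNat,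
          Real.norm_of_nonneg Real.pi_nonneg]
    _ ≤ ∫ x in -π..π, ‖filterEval F x * phase ((k : ℤ) * x)‖ :=
        intervalIntegral.norm_integral_le_integral_norm (by linarith [Real.pi_pos])
    _ = ∫ x in -π..π, ‖filterEval F x‖ := by simp only [norm_mul, norm_phase, mul_one]

end TrigPoly

section Kernel

lemma continuous_dirichletAvg (m : ℕ) : Continuous (dirichletAvg m) := by
  unfold dirichletAvg
  fun_prop

lemma dirichletAvg_periodic (m : ℕ) : Function.Periodic (dirichletAvg m) (2 * π) := fun x => by
  have h := fun n : ℕ => phase_intCast_mul_add_two_pi n x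
  simp only [Int.cast_natCast] at h
  simp only [dirichletAvg, h]

lemma dirichletAvg_eq_sum_mul (m : ℕ) (x : ℝ) :
    dirichletAvg m x = ∑ n ∈ Finset.range m, (m : ℂ)⁻¹ * phase ((n : ℤ) * x) := by
  rw [dirichletAvg, Finset.mul_sum]
  simp only [Int.cast_natCast]

lemma norm_dirichletAvg_sq_mem_trigPoly (m : ℕ) :
    (fun x => ((‖dirichletAvg m x‖ ^ 2 : ℝ) : ℂ)) ∈ trigPoly (m + m) := by
  have hmem : ∀ ν : ℕ → ℤ, (∀ n ∈ Finset.range m, |ν n| ≤ m) →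
      (fun x : ℝ => ∑ n ∈ Finset.range m, (m : ℂ)⁻¹ * phase (ν n * x)) ∈ trigPoly m := by
    intro ν hν
    convert Submodule.sum_mem (trigPoly m) fun n hn =>
      Submodule.smul_mem _ (m : ℂ)⁻¹ (phase_mem_trigPoly (hν n hn)) using 1
    funext x
    simp only [Finset.sum_apply, Pi.smul_apply, smul_eq_mul]
  have hpos := hmem (fun n => n) fun n hn => by grind
  have hneg := hmem (fun n => -n) fun n hn => by grind
  convert mul_mem_trigPoly hpos hneg using 1
  funext x
  rw [Pi.mul_apply, ← dirichletAvg_eq_sum_mul, ← Complex.normSq_eq_norm_sq, ← Complex.mul_conj]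
  congr 1
  simp [dirichletAvg_eq_sum_mul, conj_phase]

lemma integral_norm_dirichletAvg_sq {m : ℕ} (hm : 0 < m) :
    ∫ x in -π..π, ‖dirichletAvg m x‖ ^ 2 = 2 * π / m := by
  simp only [dirichletAvg_eq_sum_mul]
  rw [integral_norm_sum_phase_sq (Nat.cast_injective.injOn), Finset.sum_const, Finset.card_range,
    nsmul_eq_mul, norm_inv, Complex.norm_natCast]
  have : (m : ℝ) ≠ 0 := by positivity
  field_simp

lemma natCast_mul_abs_sin_mul_norm_dirichletAvg_le {m : ℕ} (hm : 0 < m) (x : ℝ) :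
    m * |Real.sin (x / 2)| * ‖dirichletAvg m x‖ ≤ 1 := by
  have hpow : ∀ n : ℕ, phase (n * x) = phase x ^ n := fun n => by
    rw [phase, phase, ← Complex.exp_nat_mul]
    push_cast
    ring_nf
  have hgeom : (phase x - 1) * ∑ n ∈ Finset.range m, phase (n * x) = phase (m * x) - 1 := by
    simp only [hpow, mul_geom_sum]
  have hnorm : 2 * |Real.sin (x / 2)| * (m * ‖dirichletAvg m x‖) ≤ 2 := by
    rw [natCast_mul_norm_dirichletAvg hm, ← norm_phase_sub_one, ← norm_mul, hgeom]
    refine (norm_sub_le _ _).trans ?_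
    rw [norm_phase, norm_one, one_add_one_eq_two]
  linarith

lemma div_two_pi_le_abs_sin {D x : ℝ} (hD : 0 < D) (hx : x ∈ Set.Icc (D / 2) (2 * π - D / 2)) :
    D / (2 * π) ≤ |Real.sin (x / 2)| := by
  have hjordan : ∀ y, D / 4 ≤ y → y ≤ π / 2 → D / (2 * π) ≤ Real.sin y := fun y hDy hy =>
    calc D / (2 * π) = 2 / π * (D / 4) := by field_simp; norm_num
      _ ≤ 2 / π * y := by gcongr
      _ ≤ Real.sin y := Real.mul_le_sin (by linarith) hy
  refine le_trans ?_ (le_abs_self _)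
  rcases le_total (x / 2) (π / 2) with h | h
  · exact hjordan _ (by linarith [hx.1]) h
  · rw [← Real.sin_pi_sub]
    exact hjordan _ (by linarith [hx.2]) (by linarith)

lemma norm_dirichletAvg_le_div {m : ℕ} (hm : 0 < m) {D x : ℝ} (hD : 0 < D)
    (hx : x ∈ Set.Icc (D / 2) (2 * π - D / 2)) : ‖dirichletAvg m x‖ ≤ 2 * π / (m * D) := by
  have hsin : m * (D / (2 * π)) * ‖dirichletAvg m x‖ ≤ 1 :=
    le_trans (by gcongr; exact div_two_pi_le_abs_sin hD hx)
      (natCast_mul_abs_sin_mul_norm_dirichletAvg_le hm x)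
  have hinv : m * (D / (2 * π)) = (2 * π / (m * D))⁻¹ := by rw [inv_div, mul_div_assoc]
  rwa [hinv, inv_mul_le_iff₀ (by positivity), mul_one] at hsin

/-- The Jackson kernel of order `r`, a power of the Fejér kernel, without the factor that
normalizes its mass to one. -/
def jacksonKernel (m r : ℕ) (x : ℝ) : ℝ := (‖dirichletAvg m x‖ ^ 2) ^ r

lemma continuous_jacksonKernel (m r : ℕ) : Continuous (jacksonKernel m r) :=
  ((continuous_dirichletAvg m).norm.pow 2).pow r

lemma jacksonKernel_nonneg (m r : ℕ) (x : ℝ) : 0 ≤ jacksonKernel m r x := by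
  unfold jacksonKernel
  positivity

lemma jacksonKernel_periodic (m r : ℕ) : Function.Periodic (jacksonKernel m r) (2 * π) :=
  fun x => by simp only [jacksonKernel, dirichletAvg_periodic m x]

lemma jacksonKernel_mem_trigPoly (m r : ℕ) :
    (fun x => (jacksonKernel m r x : ℂ)) ∈ trigPoly (r * (m + m)) := by
  convert pow_mem_trigPoly (norm_dirichletAvg_sq_mem_trigPoly m) r using 1
  funext x
  simp only [jacksonKernel, Complex.ofReal_pow, Pi.pow_apply]

lemma half_le_jacksonKernel {m r : ℕ} (hm : 0 < m) (hr : 0 < r) {x : ℝ}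
    (hx : |x| ≤ 1 / (4 * m * r)) : 1 / 2 ≤ jacksonKernel m r x := by
  have hr' : (1 : ℝ) ≤ r := by exact_mod_cast hr
  have hdev : (m : ℝ) * |x| ≤ 1 / (4 * r) :=
    calc (m : ℝ) * |x| ≤ m * (1 / (4 * m * r)) := by gcongr
      _ = 1 / (4 * r) := by field_simp
  have hnorm : 1 + -(1 / (4 * (r : ℝ))) ≤ ‖dirichletAvg m x‖ := by
    have := norm_sub_norm_le (1 : ℂ) (dirichletAvg m x)
    rw [norm_one] at this
    linarith [norm_one_sub_dirichletAvg_le hm x]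
  have hle : 1 / (4 * (r : ℝ)) ≤ 1 := by
    rw [div_le_one (by positivity)]
    linarith
  calc (1 / 2 : ℝ) = 1 + ((2 * r : ℕ) : ℝ) * -(1 / (4 * (r : ℝ))) := by
        push_cast; field_simp; norm_num
    _ ≤ (1 + -(1 / (4 * (r : ℝ)))) ^ (2 * r) := one_add_mul_le_pow (by linarith) _
    _ ≤ ‖dirichletAvg m x‖ ^ (2 * r) := pow_le_pow_left₀ (by linarith) hnorm _
    _ = jacksonKernel m r x := by rw [jacksonKernel, pow_mul]

lemma inv_le_integral_jacksonKernel {m r : ℕ} (hm : 0 < m) (hr : 0 < r) :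
    1 / (4 * m * r) ≤ ∫ x in -π..π, jacksonKernel m r x := by
  set w : ℝ := 1 / (4 * m * r)
  have hw : 0 < w := by positivity
  have hwπ : w ≤ π := by
    have hm' : (1 : ℝ) ≤ m := by exact_mod_cast hm
    have hr' : (1 : ℝ) ≤ r := by exact_mod_cast hr
    have : w ≤ 1 := (div_le_one (by positivity)).2 (by nlinarith)
    linarith [Real.pi_gt_three]
  have hint := (continuous_jacksonKernel m r).intervalIntegrable (μ := volume)
  calc w = ∫ x in (-w)..w, (1 / 2 : ℝ) := by
        rw [intervalIntegral.integral_const, smul_eq_mul]; ring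
    _ ≤ ∫ x in (-w)..w, jacksonKernel m r x :=
        intervalIntegral.integral_mono_on (by linarith) intervalIntegrable_const (hint _ _)
          fun x hx => half_le_jacksonKernel hm hr (abs_le.2 hx)
    _ ≤ ∫ x in -π..π, jacksonKernel m r x :=
        intervalIntegral.integral_mono_interval (by linarith) (by linarith) hwπ
          (ae_of_all _ (jacksonKernel_nonneg m r)) (hint _ _)

lemma integral_jacksonKernel_tail_le {m : ℕ} (hm : 0 < m) {D : ℝ} (hD : 0 < D) (hDπ : D ≤ 2 * π)
    (r : ℕ) : ∫ x in (D / 2)..(2 * π - D / 2), jacksonKernel m (r + 1) x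
      ≤ ((2 * π / (m * D)) ^ 2) ^ r * (2 * π / m) := by
  have hint : ∀ a b, IntervalIntegrable (fun x => ‖dirichletAvg m x‖ ^ 2) volume a b :=
    ((continuous_dirichletAvg m).norm.pow 2).intervalIntegrable
  have hperiod : ∫ x in (0 : ℝ)..(2 * π), ‖dirichletAvg m x‖ ^ 2 = 2 * π / m := by
    have hper : Function.Periodic (fun x => ‖dirichletAvg m x‖ ^ 2) (2 * π) :=
      (dirichletAvg_periodic m).comp fun z => ‖z‖ ^ 2
    have h := hper.intervalIntegral_add_eq 0 (-π)
    rwa [zero_add, show -π + 2 * π = π by ring, integral_norm_dirichletAvg_sq hm] at h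
  calc _ ≤ ∫ x in (D / 2)..(2 * π - D / 2),
        ((2 * π / (m * D)) ^ 2) ^ r * ‖dirichletAvg m x‖ ^ 2 := by
        refine intervalIntegral.integral_mono_on (by linarith)
          ((continuous_jacksonKernel m _).intervalIntegrable _ _) ((hint _ _).const_mul _)
          fun x hx => ?_
        rw [jacksonKernel, pow_succ]
        gcongr
        exact norm_dirichletAvg_le_div hm hD hx
    _ = ((2 * π / (m * D)) ^ 2) ^ r * ∫ x in (D / 2)..(2 * π - D / 2), ‖dirichletAvg m x‖ ^ 2 :=
        intervalIntegral.integral_const_mul _ _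
    _ ≤ ((2 * π / (m * D)) ^ 2) ^ r * (2 * π / m) := by
        rw [← hperiod]
        gcongr
        exact intervalIntegral.integral_mono_interval (by linarith) (by linarith) (by linarith)
          (ae_of_all _ fun x => by positivity) (hint _ _)

lemma integral_jacksonKernel_tail_le_exp_mul {m : ℕ} (hm : 0 < m) {D : ℝ} (hD : 0 < D)
    (hDπ : D ≤ 2 * π) (hmD : 18 ≤ m * D) (r : ℕ) :
    ∫ x in (D / 2)..(2 * π - D / 2), jacksonKernel m (r + 1) x
      ≤ 26 * Real.exp (-r) * ∫ x in -π..π, jacksonKernel m (r + 1) x := by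
  have hratio : 2 * π / (m * D) ≤ Real.exp (-1) := by
    rw [Real.exp_neg, ← one_div, div_le_div_iff₀ (by positivity) (Real.exp_pos 1)]
    nlinarith [Real.exp_one_lt_d9, Real.pi_lt_d2, Real.exp_pos 1]
  have hpow : ((2 * π / (m * D)) ^ 2) ^ r ≤ Real.exp (-r) * Real.exp (-r) :=
    calc ((2 * π / (m * D)) ^ 2) ^ r ≤ (Real.exp (-1) ^ 2) ^ r := by gcongr
      _ = Real.exp (-r) * Real.exp (-r) := by
          rw [← pow_mul, ← Real.exp_nat_mul, ← Real.exp_add]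
          push_cast
          ring_nf
  have hexp : ((r : ℝ) + 1) * Real.exp (-r) ≤ 1 := by
    rw [Real.exp_neg, ← div_eq_mul_inv, div_le_one (Real.exp_pos _)]
    exact Real.add_one_le_exp _
  calc _ ≤ ((2 * π / (m * D)) ^ 2) ^ r * (2 * π / m) :=
        integral_jacksonKernel_tail_le hm hD hDπ r
    _ ≤ Real.exp (-r) * Real.exp (-r) * (2 * π / m) := by gcongr
    _ = 8 * π * Real.exp (-r) * (((r + 1) * Real.exp (-r)) * (1 / (4 * m * (r + 1 : ℕ)))) := by
        push_cast; field_simp; norm_num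
    _ ≤ 26 * Real.exp (-r) * (1 * ∫ x in -π..π, jacksonKernel m (r + 1) x) := by
        gcongr
        · linarith [Real.pi_lt_d2]
        · exact inv_le_integral_jacksonKernel hm r.succ_pos
    _ = _ := by rw [one_mul]

/-- A probability kernel on the circle that has mass at most `T` at distance at least `D / 2` from
the origin. -/
structure IsLocalizedKernel (K : ℝ → ℝ) (D T : ℝ) : Prop where
  continuous : Continuous K
  nonneg : ∀ x, 0 ≤ K x
  periodic : Function.Periodic K (2 * π)
  integral_eq_one : ∫ x in -π..π, K x = 1
  integral_tail_le : ∫ x in (D / 2)..(2 * π - D / 2), K x ≤ T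

lemma IsLocalizedKernel.mono {K : ℝ → ℝ} {D T T' : ℝ} (h : IsLocalizedKernel K D T)
    (hT : T ≤ T') : IsLocalizedKernel K D T' :=
  { h with integral_tail_le := h.integral_tail_le.trans hT }

lemma isLocalizedKernel_jacksonKernel {m : ℕ} (hm : 0 < m) {D : ℝ} (hD : 0 < D) (hDπ : D ≤ 2 * π)
    (hmD : 18 ≤ m * D) (r : ℕ) :
    IsLocalizedKernel
      (fun x => (∫ y in -π..π, jacksonKernel m (r + 1) y)⁻¹ * jacksonKernel m (r + 1) x)
      D (26 * Real.exp (-r)) := by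
  have hmass : 0 < ∫ y in -π..π, jacksonKernel m (r + 1) y :=
    lt_of_lt_of_le (by positivity) (inv_le_integral_jacksonKernel hm r.succ_pos)
  refine ⟨continuous_const.mul (continuous_jacksonKernel _ _),
    fun x => mul_nonneg (inv_nonneg.2 hmass.le) (jacksonKernel_nonneg _ _ _),
    (jacksonKernel_periodic m (r + 1)).comp fun y => _ * y, ?_, ?_⟩
  · rw [intervalIntegral.integral_const_mul, inv_mul_cancel₀ hmass.ne']
  · rw [intervalIntegral.integral_const_mul, inv_mul_le_iff₀' hmass]
    exact integral_jacksonKernel_tail_le_exp_mul hm hD hDπ hmD r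

lemma exists_isLocalizedKernel {D q : ℝ} (hD : 0 < D) (hDπ : D ≤ 2 * π) (hq : 0 < q)
    (hq₁ : q ≤ 1) :
    ∃ (d : ℕ) (K : ℝ → ℝ), (d : ℝ) ≤ 50 * (Real.log (26 / q) + 2) / D ∧
      (fun x => (K x : ℂ)) ∈ trigPoly d ∧ IsLocalizedKernel K D q := by
  set r := ⌈Real.log (26 / q)⌉₊
  have hr : (r : ℝ) < Real.log (26 / q) + 1 := Nat.ceil_lt_add_one <| Real.log_nonneg <| by
    rw [le_div_iff₀ hq]
    linarith
  have htail : 26 * Real.exp (-r) ≤ q := by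
    have := Real.exp_le_exp.2 (neg_le_neg (Nat.le_ceil (Real.log (26 / q))))
    rw [Real.exp_neg (Real.log _), Real.exp_log (by positivity), inv_div] at this
    linarith
  set m := ⌈18 / D⌉₊
  have hm : 0 < m := Nat.ceil_pos.2 (by positivity)
  have hmD : 18 ≤ m * D := (div_le_iff₀ hD).1 (Nat.le_ceil _)
  have hm_le : (m + m) * D ≤ 50 := by
    have := mul_lt_mul_of_pos_right (Nat.ceil_lt_add_one (show 0 ≤ 18 / D by positivity)) hD
    rw [add_mul, div_mul_cancel₀ _ hD.ne'] at this
    linarith [Real.pi_lt_d2]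
  refine ⟨(r + 1) * (m + m), _, ?_, ?_,
    (isLocalizedKernel_jacksonKernel hm hD hDπ hmD r).mono htail⟩
  · rw [le_div_iff₀ hD]
    push_cast
    nlinarith
  · convert Submodule.smul_mem _ ((∫ y in -π..π, jacksonKernel m (r + 1) y)⁻¹ : ℂ)
      (jacksonKernel_mem_trigPoly m (r + 1)) using 1
    funext x
    rw [Complex.ofReal_mul, Complex.ofReal_inv, ← intervalIntegral.integral_ofReal, Pi.smul_apply,
      smul_eq_mul]

end Kernel

section Filter

lemma sum_freq_inv_le (d : ℕ) :
    ∑ l : Freq d, (if (l : ℤ) = 0 then (1 : ℝ) else 1 / 3 / |((l : ℤ) : ℝ)|) ≤ 3 * logE d := by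
  have heven : Function.Even fun l : ℤ => if l = 0 then (1 : ℝ) else 1 / 3 / |(l : ℝ)| := by
    intro l
    simp
  have hterm : ∀ i ∈ Finset.range d, (if ((i + 1 : ℕ) : ℤ) = 0 then (1 : ℝ)
      else 1 / 3 / |(((i + 1 : ℕ) : ℤ) : ℝ)|) = 1 / 3 * ((i + 1 : ℕ) : ℝ)⁻¹ := fun i _ => by
    rw [if_neg (by lia), Int.cast_natCast, Nat.abs_cast, div_eq_mul_inv (1 / 3 : ℝ)]
  have hharmonic : ∑ i ∈ Finset.range d, ((i + 1 : ℕ) : ℝ)⁻¹ ≤ 1 + Real.log d := by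
    simpa [harmonic] using harmonic_le_one_add_log d
  have hlog : Real.log d ≤ logE d := by
    rcases Nat.eq_zero_or_pos d with rfl | hd
    · rw [Nat.cast_zero, Real.log_zero]
      exact zero_le_one.trans (one_le_logE le_rfl)
    · exact log_le_logE (by exact_mod_cast hd)
  rw [Finset.sum_coe_sort _ fun l : ℤ => if l = 0 then (1 : ℝ) else 1 / 3 / |(l : ℝ)|,
    Finset.sum_Icc_of_even_eq_range heven, Finset.sum_range_succ', Finset.sum_congr rfl hterm,
    ← Finset.mul_sum, Nat.cast_zero, if_pos rfl, nsmul_eq_mul, Nat.cast_ofNat]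
  linarith [one_le_logE (Nat.cast_nonneg (α := ℝ) d)]

lemma filterEval_mul_integral_phase {d : ℕ} (F : Freq d → ℂ) (a b x : ℝ) :
    filterEval (fun l => F l * ∫ y in a..b, phase ((l : ℤ) * y)) x
      = ∫ y in a..b, filterEval F (x - y) := by
  have hexpand : ∀ y : ℝ, filterEval F (x - y)
      = ∑ l : Freq d, (F l * phase (-((l : ℤ) * x))) * phase ((l : ℤ) * y) := fun y => by
    rw [filterEval_eq_sum_phase]
    refine Finset.sum_congr rfl fun l _ => ?_
    rw [mul_assoc, ← phase_add]
    ring_nf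
  simp only [hexpand]
  rw [filterEval_eq_sum_phase,
    intervalIntegral.integral_finsetSum fun l _ => intervalIntegrable_mul_phase _ _ _ _]
  refine Finset.sum_congr rfl fun l _ => ?_
  rw [intervalIntegral.integral_const_mul]
  ring

lemma filterNorm_mul_integral_phase_le {d : ℕ} {F : Freq d → ℂ}
    (hF : ∫ x in -π..π, ‖filterEval F x‖ ≤ 1) {a b : ℝ} (hab : |b - a| ≤ 2 * π) :
    filterNorm (fun l => F l * ∫ y in a..b, phase ((l : ℤ) * y)) ≤ 3 * logE d := by
  refine le_trans (Finset.sum_le_sum fun l _ => ?_) (sum_freq_inv_le d)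
  have hcoeff := (two_pi_mul_norm_le_integral_norm_filterEval F l).trans hF
  rw [norm_mul]
  split_ifs with hl
  · have hint : ‖∫ y in a..b, phase ((l : ℤ) * y)‖ ≤ 2 * π := by
      refine (intervalIntegral.norm_integral_le_of_norm_le_const
        fun y _ => (norm_phase _).le).trans ?_
      rwa [one_mul]
    calc ‖F l‖ * ‖∫ y in a..b, phase ((l : ℤ) * y)‖ ≤ ‖F l‖ * (2 * π) := by gcongr
      _ ≤ 1 := by rwa [mul_comm]
  · have hFl : ‖F l‖ ≤ 1 / 6 := by nlinarith [norm_nonneg (F l), Real.pi_gt_three]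
    calc ‖F l‖ * ‖∫ y in a..b, phase ((l : ℤ) * y)‖ ≤ 1 / 6 * (2 / |((l : ℤ) : ℝ)|) := by
          gcongr
          exact norm_integral_phase_intCast_mul_le hl a b
      _ = 1 / 3 / |((l : ℤ) : ℝ)| := by ring

namespace IsLocalizedKernel

variable {K : ℝ → ℝ} {a b D T x : ℝ}

lemma integral_eq_one' (hK : IsLocalizedKernel K D T) (c : ℝ) : ∫ x in c..c + 2 * π, K x = 1 := by
  rw [hK.periodic.intervalIntegral_add_eq c (-π), show -π + 2 * π = π by ring, hK.integral_eq_one]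

lemma integral_mono_interval (hK : IsLocalizedKernel K D T) {c d : ℝ} (hca : c ≤ a) (hab : a ≤ b)
    (hbd : b ≤ d) : ∫ x in a..b, K x ≤ ∫ x in c..d, K x :=
  intervalIntegral.integral_mono_interval hca hab hbd (ae_of_all _ hK.nonneg)
    (hK.continuous.intervalIntegrable _ _)

lemma integral_comp_sub_mem_Icc (hK : IsLocalizedKernel K D T) (hab : a ≤ b)
    (hba : b - a ≤ 2 * π) (x : ℝ) : ∫ y in a..b, K (x - y) ∈ Set.Icc 0 1 := by
  rw [intervalIntegral.integral_comp_sub_left]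
  refine ⟨intervalIntegral.integral_nonneg (by linarith) fun y _ => hK.nonneg y, ?_⟩
  rw [← hK.integral_eq_one' (x - b)]
  exact hK.integral_mono_interval le_rfl (by linarith) (by linarith)

lemma one_sub_le_integral_comp_sub (hK : IsLocalizedKernel K D T) (hba : b - a ≤ 2 * π)
    (hax : a + D / 2 ≤ x) (hxb : x ≤ b - D / 2) : 1 - T ≤ ∫ y in a..b, K (x - y) := by
  rw [intervalIntegral.integral_comp_sub_left]
  have hint := hK.continuous.intervalIntegrable (μ := volume)
  have hsplit := intervalIntegral.integral_add_adjacent_intervals (hint (x - b) (x - a))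
    (hint (x - a) (x - b + 2 * π))
  have htail : ∫ y in (x - a)..(x - b + 2 * π), K y ≤ T :=
    (hK.integral_mono_interval (by linarith) (by linarith) (by linarith)).trans hK.integral_tail_le
  linarith [hK.integral_eq_one' (x - b)]

lemma integral_comp_sub_le (hK : IsLocalizedKernel K D T) (hab : a ≤ b) (ha : -π + D / 2 ≤ a)
    (hb : b ≤ π - D / 2) (hx : x ∈ Set.Icc (-π) π) (hxab : x ≤ a - D / 2 ∨ b + D / 2 ≤ x) :
    ∫ y in a..b, K (x - y) ≤ T := by
  rw [intervalIntegral.integral_comp_sub_left]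
  refine le_trans ?_ hK.integral_tail_le
  rcases hxab with hxa | hbx
  · have hshift : ∫ y in (x - b)..(x - a), K y = ∫ y in (x - b + 2 * π)..(x - a + 2 * π), K y := by
      rw [← intervalIntegral.integral_comp_add_right]
      exact intervalIntegral.integral_congr fun y _ => (hK.periodic y).symm
    rw [hshift]
    exact hK.integral_mono_interval (by linarith [hx.1]) (by linarith) (by linarith)
  · exact hK.integral_mono_interval (by linarith) (by linarith) (by linarith [hx.2])

end IsLocalizedKernel

section GapDist

variable {I I' : Set ℝ} {x y : ℝ}

lemma gapDist_le_abs_sub (hx : x ∉ I') (hy : y ∈ I) : gapDist I I' ≤ |x - y| := by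
  refine csInf_le ⟨0, ?_⟩ ⟨x, hx, y, hy, rfl⟩
  rintro s ⟨x, _, y, _, rfl⟩
  exact abs_nonneg _

lemma subset_Icc_gapDist (hII' : I ⊆ I') (hI' : I' ⊆ Set.Icc (-π) π) :
    I ⊆ Set.Icc (-π + gapDist I I') (π - gapDist I I') := by
  intro y hy
  obtain ⟨hπy, hyπ⟩ := hI' (hII' hy)
  constructor
  · by_contra! hlt
    have hx : (y - gapDist I I' + -π) / 2 ∉ I' := fun h => by linarith [(hI' h).1]
    have := gapDist_le_abs_sub hx hy
    rw [abs_sub_comm, abs_of_nonneg (by linarith)] at this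
    linarith
  · by_contra! hlt
    have hx : (y + gapDist I I' + π) / 2 ∉ I' := fun h => by linarith [(hI' h).2]
    have := gapDist_le_abs_sub hx hy
    rw [abs_of_nonneg (by linarith)] at this
    linarith

lemma sInf_sSup_bounds (hne : I.Nonempty) (hII' : I ⊆ I') (hI' : I' ⊆ Set.Icc (-π) π) :
    -π + gapDist I I' ≤ sInf I ∧ sInf I ≤ sSup I ∧ sSup I ≤ π - gapDist I I' := by
  have hsub := subset_Icc_gapDist hII' hI'
  exact ⟨le_csInf hne fun y hy => (hsub hy).1,
    csInf_le_csSup hne (bddBelow_Icc.mono hsub) (bddAbove_Icc.mono hsub),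
    csSup_le hne fun y hy => (hsub hy).2⟩

lemma add_gapDist_le_sInf_or_sSup_add_gapDist_le (hI : I.OrdConnected) (hne : I.Nonempty)
    (hII' : I ⊆ I') (hx : x ∉ I') : x + gapDist I I' ≤ sInf I ∨ sSup I + gapDist I I' ≤ x := by
  by_cases hleft : ∀ y ∈ I, x ≤ y
  · left
    refine le_csInf hne fun y hy => ?_
    have := gapDist_le_abs_sub hx hy
    rw [abs_sub_comm, abs_of_nonneg (sub_nonneg.2 (hleft y hy))] at this
    linarith
  · right
    push Not at hleft
    obtain ⟨z, hz, hzx⟩ := hleft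
    rw [← le_sub_iff_add_le]
    refine csSup_le hne fun y hy => ?_
    have hyx : y ≤ x := le_of_not_gt fun hxy => hx (hII' (hI.out hz hy ⟨hzx.le, hxy.le⟩))
    have := gapDist_le_abs_sub hx hy
    rw [abs_of_nonneg (sub_nonneg.2 hyx)] at this
    linarith

end GapDist

section Existence

variable {I I' : Set ℝ}

lemma isFilter_of_eq_integral (hI : I.OrdConnected) (hne : I.Nonempty) (hII' : I ⊆ I')
    (hI' : I' ⊆ Set.Icc (-π) π) (hD : 0 < gapDist I I') {q : ℝ} (hq : 0 ≤ q) {K : ℝ → ℝ}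
    (hK : IsLocalizedKernel K (gapDist I I') q) {d : ℕ} {F : Freq d → ℂ}
    (hF : ∀ x, filterEval F x = ((∫ y in (sInf I - gapDist I I' / 2)..(sSup I + gapDist I I' / 2),
      K (x - y) : ℝ) : ℂ)) : IsFilter F q I I' := by
  have hsub := subset_Icc_gapDist hII' hI'
  have hbelow : BddBelow I := bddBelow_Icc.mono hsub
  have habove : BddAbove I := bddAbove_Icc.mono hsub
  obtain ⟨hinf, hle, hsup⟩ := sInf_sSup_bounds hne hII' hI'
  have hrange := hK.integral_comp_sub_mem_Icc (a := sInf I - gapDist I I' / 2)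
    (b := sSup I + gapDist I I' / 2) (by linarith) (by linarith)
  have hnorm : ∀ x, ‖filterEval F x‖ = _ := fun x => by
    rw [hF, Complex.norm_real, Real.norm_of_nonneg (hrange x).1]
  refine ⟨fun x hx => ?_, fun x hx => ?_, fun x => ?_⟩
  · have hlow := hK.one_sub_le_integral_comp_sub (a := sInf I - gapDist I I' / 2)
      (b := sSup I + gapDist I I' / 2) (x := x) (by linarith)
      (by linarith [csInf_le hbelow hx]) (by linarith [le_csSup habove hx])
    rw [hF, ← Complex.ofReal_one, ← Complex.ofReal_sub, Complex.norm_real, norm_sub_rev,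
      Real.norm_of_nonneg (sub_nonneg.2 (hrange x).2)]
    linarith
  · rw [hnorm]
    refine hK.integral_comp_sub_le (by linarith) (by linarith) (by linarith) hx.1 ?_
    exact (add_gapDist_le_sInf_or_sSup_add_gapDist_le hI hne hII' hx.2).imp
      (fun h => by linarith) fun h => by linarith
  · rw [hnorm]
    linarith [(hrange x).2]

lemma exists_isFilter (hI : I.OrdConnected) (hne : I.Nonempty) (hII' : I ⊆ I')
    (hI' : I' ⊆ Set.Icc (-π) π) (hD : 0 < gapDist I I') {q : ℝ} (hq : 0 < q) (hq₁ : q ≤ 1) {d : ℕ}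
    (hd : 50 * (Real.log (26 / q) + 2) / gapDist I I' ≤ d) :
    ∃ F : Freq d → ℂ, IsFilter F q I I' ∧ filterNorm F ≤ 3 * logE d := by
  obtain ⟨hinf, hle, hsup⟩ := sInf_sSup_bounds hne hII' hI'
  obtain ⟨e, K, he, htrig, hK⟩ := exists_isLocalizedKernel hD (by linarith) hq hq₁
  obtain ⟨F, hF⟩ := mem_trigPoly_iff.1 (trigPoly_mono (by exact_mod_cast he.trans hd) htrig)
  refine ⟨_, isFilter_of_eq_integral hI hne hII' hI' hD hq.le hK fun x => ?_,
    filterNorm_mul_integral_phase_le (F := F) (a := sInf I - gapDist I I' / 2)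
      (b := sSup I + gapDist I I' / 2) ?_ (abs_le.2 ⟨by linarith, by linarith⟩)⟩
  · rw [filterEval_mul_integral_phase, hF, intervalIntegral.integral_ofReal]
  · simp only [hF, Complex.norm_real, Real.norm_of_nonneg (hK.nonneg _), hK.integral_eq_one, le_rfl]

lemma log_div_le_logE_add {κ p δ q : ℝ} (hκ : 0 < κ) (hp : 0 < p) (hp₁ : p ≤ 1) (hδ : 0 < δ)
    (hq : κ * (p * δ ^ 2) ≤ q) :
    Real.log (26 / q) ≤ logE (26 / κ) + 2 * logE (p⁻¹ * δ⁻¹) := by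
  have hq₀ : 0 < q := lt_of_lt_of_le (by positivity) hq
  have hle : 26 / q ≤ 26 / κ * (p⁻¹ * δ⁻¹) ^ 2 :=
    calc 26 / q ≤ 26 / (κ * (p * δ ^ 2)) := by gcongr
      _ ≤ 26 / (κ * (p ^ 2 * δ ^ 2)) := by
          gcongr
          exact pow_le_of_le_one hp.le hp₁ two_ne_zero
      _ = 26 / κ * (p⁻¹ * δ⁻¹) ^ 2 := by field_simp
  calc Real.log (26 / q) ≤ logE (26 / q) := log_le_logE (by positivity)
    _ ≤ logE (26 / κ * (p⁻¹ * δ⁻¹) ^ 2) := logE_mono (by positivity) hle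
    _ ≤ logE (26 / κ) + logE ((p⁻¹ * δ⁻¹) ^ 2) := logE_mul_le (by positivity) (by positivity)
    _ ≤ logE (26 / κ) + 2 * logE (p⁻¹ * δ⁻¹) := by
        gcongr
        exact_mod_cast logE_pow_le (show 0 ≤ p⁻¹ * δ⁻¹ by positivity) two_ne_zero

lemma gapDist_le_eight (hne : I.Nonempty) (hII' : I ⊆ I') (hI' : I' ⊆ Set.Icc (-π) π) :
    gapDist I I' ≤ 8 := by
  obtain ⟨y, hy⟩ := hne
  have := subset_Icc_gapDist hII' hI' hy
  linarith [this.1.trans this.2, Real.pi_lt_d2]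

lemma exists_filterSize_constant {κ : ℝ} (hκ : 0 < κ) :
    ∃ A₀ ≥ (1 : ℝ), ∀ A ≥ A₀, ∀ {I I' : Set ℝ} {p δ q : ℝ}, I.OrdConnected → I.Nonempty → I ⊆ I' →
      I' ⊆ Set.Icc (-π) π → 0 < gapDist I I' → 0 < p → p ≤ 1 → 0 < δ →
      κ * (p * δ ^ 2) ≤ q → q ≤ 1 →
      ∃ (d : ℕ) (F : Freq d → ℂ), IsFilter F q I I' ∧ FilterSize F A 1 (gapDist I I') p δ := by
  set A₁ := 50 * (logE (26 / κ) + 4)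
  have hlogE : 1 ≤ logE (26 / κ) := one_le_logE (by positivity)
  refine ⟨A₁ + 8, by linarith, ?_⟩
  intro A hA I I' p δ q hI hne hII' hI' hD hp hp₁ hδ hq hq₁
  have hq₀ : 0 < q := lt_of_lt_of_le (by positivity) hq
  set D := gapDist I I'
  set L := logE (p⁻¹ * δ⁻¹)
  have hpolylog : polylog 1 (p⁻¹ * δ⁻¹) = L := pow_one _
  have hL : 1 ≤ L := one_le_logE (by positivity)
  have hDL : 1 / 8 ≤ D⁻¹ * L := by
    have : 8⁻¹ ≤ D⁻¹ := inv_anti₀ hD (gapDist_le_eight hne hII' hI')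
    nlinarith
  set d := ⌈A₁ * (D⁻¹ * L)⌉₊
  have hd_ge : A₁ * (D⁻¹ * L) ≤ d := Nat.le_ceil _
  have hd_lt : (d : ℝ) < A₁ * (D⁻¹ * L) + 1 := Nat.ceil_lt_add_one (by positivity)
  obtain ⟨F, hF, hFnorm⟩ := exists_isFilter hI hne hII' hI' hD hq₀ hq₁ (d := d) <|
    calc 50 * (Real.log (26 / q) + 2) / D ≤ A₁ * L / D := by
          refine div_le_div_of_nonneg_right ?_ hD.le
          nlinarith [log_div_le_logE_add hκ hp hp₁ hδ hq]
      _ = A₁ * (D⁻¹ * L) := by ring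
      _ ≤ d := hd_ge
  refine ⟨d, F, hF, ?_, ?_, hFnorm.trans ?_⟩
  · rw [hpolylog]
    refine le_trans ?_ hd_ge
    gcongr
    exact (inv_le_one_of_one_le₀ (by linarith)).trans (by linarith)
  · rw [hpolylog]
    have : (A₁ + 8) * (D⁻¹ * L) ≤ A * (D⁻¹ * L) := by gcongr
    linarith
  · exact mul_le_mul_of_nonneg_right (by linarith)
      (zero_le_one.trans (one_le_logE (Nat.cast_nonneg d)))

end Existence

end Filter

section Times

variable {ε δ : ℝ} {d J N Ns : ℕ}

lemma sum_timeStep (ε δ : ℝ) (N J : ℕ) :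
    ∑ i ∈ Finset.range (J + 1), timeStep ε δ N i = 2 * timeStep ε δ N J - timeStep ε δ N 0 := by
  induction J with
  | zero => rw [Finset.sum_range_one]; ring
  | succ J ih => rw [Finset.sum_range_succ, ih, timeStep_succ]; ring

lemma timeStep_last_le_sum (hε : 0 < ε) (hδ : 0 < δ) (hN : 0 < N) :
    timeStep ε δ N (numLevels ε - 1) ≤ ∑ i ∈ Finset.range (numLevels ε), timeStep ε δ N i :=
  Finset.single_le_sum (fun i _ => (timeStep_pos hε hδ hN i).le)
    (Finset.mem_range.2 (Nat.lt_succ_self _))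

lemma sum_timeStep_le_two_mul_last (hε : 0 < ε) (hδ : 0 < δ) (hN : 0 < N) :
    ∑ i ∈ Finset.range (numLevels ε), timeStep ε δ N i
      ≤ 2 * timeStep ε δ N (numLevels ε - 1) :=
  (sum_timeStep ε δ N (numLevels ε - 1)).trans_le (sub_le_self _ (timeStep_pos hε hδ hN 0).le)

lemma maxTime_timeStep (hN : 0 < N) (ε δ : ℝ) (d : ℕ) :
    maxTime d (numLevels ε) N (timeStep ε δ N) = d + δ / ε := by
  rw [maxTime, mul_timeStep_last hN]

lemma circuitTime_le {τ : ℕ → ℝ} (hτ : ∀ i, 0 ≤ τ i) (ω : Outcomes d J N Ns)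
    (a : Fin J × Fin N × Fin Ns) : circuitTime τ ω a ≤ d + ((a.2.1 : ℕ) : ℝ) * τ a.1 := by
  have hfreq := Finset.mem_Icc.1 (ω a).1.2
  have habs : |(((ω a).1 : ℤ) : ℝ)| ≤ d :=
    abs_le.2 ⟨by exact_mod_cast hfreq.1, by exact_mod_cast hfreq.2⟩
  calc circuitTime τ ω a ≤ |(((ω a).1 : ℤ) : ℝ)| + |((a.2.1 : ℕ) : ℝ) * τ a.1| := abs_add_le _ _
    _ ≤ d + ((a.2.1 : ℕ) : ℝ) * τ a.1 := by
        rw [abs_of_nonneg (mul_nonneg (Nat.cast_nonneg _) (hτ _))]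
        gcongr

lemma circuitTime_timeStep_le (hε : 0 < ε) (hδ : 0 < δ) (ω : Outcomes d (numLevels ε) N Ns)
    (a : Fin (numLevels ε) × Fin N × Fin Ns) :
    circuitTime (timeStep ε δ N) ω a ≤ d + δ / ε := by
  have hN : 0 < N := a.2.1.pos
  refine (circuitTime_le (fun i => (timeStep_pos hε hδ hN i).le) ω a).trans ?_
  rw [← mul_timeStep_last hN ε δ]
  have hstep := timeStep_mono hε hδ hN (Nat.le_sub_one_of_lt a.1.isLt)
  have := timeStep_pos hε hδ hN a.1
  gcongr
  exact a.2.1.isLt.le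

lemma sum_circuitTime_le {τ : ℕ → ℝ} (hτ : ∀ i, 0 ≤ τ i) (ω : Outcomes d J N Ns) :
    ∑ a, 2 * circuitTime τ ω a ≤ totalTime d J N Ns τ := by
  calc ∑ a, 2 * circuitTime τ ω a
      ≤ ∑ a : Fin J × Fin N × Fin Ns, 2 * (d + ((a.2.1 : ℕ) : ℝ) * τ a.1) := by
        gcongr with a
        exact circuitTime_le hτ ω a
    _ = totalTime d J N Ns τ := by
        simp only [totalTime, Finset.sum_range, Fintype.sum_prod_type, Finset.sum_const,
          Finset.card_univ, Fintype.card_fin, nsmul_eq_mul]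
        congr! 2
        ring

lemma totalTime_eq (d J N Ns : ℕ) (τ : ℕ → ℝ) :
    totalTime d J N Ns τ
      = 2 * (N * Ns) * (J * d + (N - 1) / 2 * ∑ i ∈ Finset.range J, τ i) := by
  have hgauss : ∑ n ∈ Finset.range N, (n : ℝ) = N * (N - 1) / 2 := by
    induction N with
    | zero => simp
    | succ N ih => rw [Finset.sum_range_succ, ih]; push_cast; ring
  simp only [totalTime, ← Finset.mul_sum, Finset.sum_add_distrib, ← Finset.sum_mul, hgauss,
    Finset.sum_const, Finset.card_range, nsmul_eq_mul]
  ring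

lemma le_totalTime_timeStep {C X : ℝ} (hε : 0 < ε) (hδ : 0 < δ) (hN : 2 ≤ N) (d : ℕ)
    (hX : C * X ≤ N * Ns) :
    C / 2 * X * (numLevels ε * d + δ / ε)
      ≤ totalTime d (numLevels ε) N Ns (timeStep ε δ N) := by
  have hN₀ : 0 < N := by omega
  have hN₂ : (2 : ℝ) ≤ N := by exact_mod_cast hN
  have hsum := timeStep_last_le_sum hε hδ hN₀
  have hlast := timeStep_pos hε hδ hN₀ (numLevels ε - 1)
  rw [totalTime_eq, ← mul_timeStep_last hN₀ ε δ]
  set t := timeStep ε δ N (numLevels ε - 1)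
  calc C / 2 * X * (numLevels ε * d + N * t)
      = 2 * (C * X) * (numLevels ε * d / 4 + N / 4 * t) := by ring
    _ ≤ 2 * (N * Ns) * (numLevels ε * d
          + (N - 1) / 2 * ∑ i ∈ Finset.range (numLevels ε), timeStep ε δ N i) := by
        gcongr 2 * ?_ * (?_ + ?_)
        · exact div_le_self (by positivity) (by norm_num)
        · exact mul_le_mul (by linarith) hsum hlast.le (by linarith)

lemma totalTime_timeStep_le {B X : ℝ} (hε : 0 < ε) (hδ : 0 < δ) (hN : 0 < N) (d : ℕ)
    (hX : N * Ns ≤ B * X) :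
    totalTime d (numLevels ε) N Ns (timeStep ε δ N)
      ≤ 2 * B * X * (numLevels ε * d + δ / ε) := by
  have hN₁ : (1 : ℝ) ≤ N := by exact_mod_cast hN
  have hsum := sum_timeStep_le_two_mul_last hε hδ hN
  have hlast := timeStep_pos hε hδ hN (numLevels ε - 1)
  have hsum_nonneg := hlast.le.trans (timeStep_last_le_sum hε hδ hN)
  rw [totalTime_eq, ← mul_timeStep_last hN ε δ, mul_assoc 2 B X]
  set t := timeStep ε δ N (numLevels ε - 1)
  have hslope : (N - 1 : ℝ) / 2 * ∑ i ∈ Finset.range (numLevels ε), timeStep ε δ N i ≤ N * t :=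
    calc _ ≤ N / 2 * (2 * t) := mul_le_mul (by linarith) hsum hsum_nonneg (by linarith)
      _ = N * t := by ring
  calc _ ≤ 2 * (N * Ns) * (numLevels ε * d + N * t) := by gcongr
    _ ≤ _ := by gcongr
end Times

end QCELS

end

theorem mainTheorem3 :
    -- `p_r` close to `1` and `δ = Θ(√(1 - p_r))`: `c₁ √(1 - p_r) ≤ δ ≤ δ₀`
    ∃ c₁ > (0 : ℝ), ∃ δ₀ > (0 : ℝ), ∃ κ > (0 : ℝ), ∃ k₁ k₂ : ℕ,
    -- `q = Θ(p₀ δ²)`: `κ' p₀ δ² ≤ q ≤ κ p₀ δ²`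
    ∀ κ' : ℝ, 0 < κ' → κ' ≤ κ →
    ∃ A₀ ≥ (1 : ℝ), ∀ A ≥ A₀, ∀ ζ : ℝ, 0 < ζ → ζ < 1 →
    ∃ C > (0 : ℝ),
    ∀ (E : Type*) [NormedAddCommGroup E] [InnerProductSpace ℂ E] (M : ℕ)
      (H : E →L[ℂ] E) (v : OrthonormalBasis (Fin (M + 1)) ℂ E) (lam : Fin (M + 1) → ℝ) (ψ : E)
      (I I' : Set ℝ) (δ q ε η : ℝ),
      QCELS.IsEigensystem H v lam →
      (∀ m, lam m ∈ Set.Icc (-Real.pi) Real.pi) →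
      ‖ψ‖ = 1 →
      0 < QCELS.overlap v ψ 0 →
      I.OrdConnected → I'.OrdConnected → lam 0 ∈ I → I ⊆ I' →
      I' ⊆ Set.Icc (-Real.pi) Real.pi →
      0 < QCELS.gapDist I I' →
      0 < δ → c₁ * Real.sqrt (1 - QCELS.relOverlap v lam ψ I I') ≤ δ → δ ≤ δ₀ →
      κ' * (QCELS.overlap v ψ 0 * δ ^ 2) ≤ q → q ≤ κ * (QCELS.overlap v ψ 0 * δ ^ 2) →
      0 < ε → ε < 1 / 2 → 0 < η → η < 1 →
      -- suitable filters exist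
      (∃ (d : ℕ) (F : QCELS.Freq d → ℂ), QCELS.IsFilter F q I I' ∧
        QCELS.FilterSize F A k₁ (QCELS.gapDist I I') (QCELS.overlap v ψ 0) δ) ∧
      -- and the algorithm works with each of them
      ∀ (d : ℕ) (F : QCELS.Freq d → ℂ), QCELS.IsFilter F q I I' →
        QCELS.FilterSize F A k₁ (QCELS.gapDist I I') (QCELS.overlap v ψ 0) δ →
        ∀ N Ns : ℕ, 2 ≤ N →
          C * QCELS.sampleBound k₂ ζ ε η (QCELS.overlap v ψ 0) δ (QCELS.gapDist I I') ≤
            (N : ℝ) * Ns →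
          -- precision `ε` with probability at least `1 - η`
          1 - η ≤ (QCELS.outcomesLaw H ψ F (QCELS.numLevels ε) N Ns
              (QCELS.timeStep ε δ N)).real
            (QCELS.successEvent F (QCELS.timeStep ε δ N) (lam 0) ε) ∧
          -- maximal evolution time
          QCELS.maxTime d (QCELS.numLevels ε) N (QCELS.timeStep ε δ N) = d + δ / ε ∧
          (∀ (ω : QCELS.Outcomes d (QCELS.numLevels ε) N Ns)
              (a : Fin (QCELS.numLevels ε) × Fin N × Fin Ns),
            QCELS.circuitTime (QCELS.timeStep ε δ N) ω a ≤ d + δ / ε) ∧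
          -- total evolution time
          (∀ ω : QCELS.Outcomes d (QCELS.numLevels ε) N Ns,
            ∑ a, 2 * QCELS.circuitTime (QCELS.timeStep ε δ N) ω a ≤
              QCELS.totalTime d (QCELS.numLevels ε) N Ns (QCELS.timeStep ε δ N)) ∧
          C / 2 * QCELS.sampleBound k₂ ζ ε η (QCELS.overlap v ψ 0) δ (QCELS.gapDist I I') *
              (QCELS.numLevels ε * d + δ / ε) ≤
            QCELS.totalTime d (QCELS.numLevels ε) N Ns (QCELS.timeStep ε δ N) ∧
          ∀ B : ℝ,
            (N : ℝ) * Ns ≤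
              B * QCELS.sampleBound k₂ ζ ε η (QCELS.overlap v ψ 0) δ (QCELS.gapDist I I') →
            QCELS.totalTime d (QCELS.numLevels ε) N Ns (QCELS.timeStep ε δ N) ≤
              2 * B *
                QCELS.sampleBound k₂ ζ ε η (QCELS.overlap v ψ 0) δ (QCELS.gapDist I I') *
                (QCELS.numLevels ε * d + δ / ε) := by
  refine ⟨2000, by norm_num, 1, by norm_num, 1 / 400000, by norm_num, 1, 3, fun κ' hκ' _ => ?_⟩
  obtain ⟨A₀, hA₀, hfilter⟩ := QCELS.exists_filterSize_constant hκ'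
  refine ⟨A₀, hA₀, fun A hA ζ hζ hζ₁ => ?_⟩
  obtain ⟨C, hC, hsample⟩ := QCELS.exists_sample_constant (A := A) (s := 1 / 600000)
    (by linarith) hζ hζ₁ (by norm_num)
  refine ⟨C, hC, ?_⟩
  intro E _ _ M H v lam ψ I I' δ q ε η hH hlam hψ hp hI _ hlam₀ hII' hI' hD hδ hrel hδ₁ hq hq'
    hε hε₁ hη hη₁
  have hp₁ := QCELS.overlap_le_one (v := v) hψ 0
  have hq₁ : q < 1 := by linarith [QCELS.overlap_mul_sq_le_one (v := v) hψ 0 hδ.le hδ₁]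
  refine ⟨hfilter A hA hI ⟨_, hlam₀⟩ hII' hI' hD hp hp₁ hδ hq hq₁.le, ?_⟩
  intro d F hF ⟨_, hd, hnorm⟩ N Ns hN hNNs
  have hN₀ : 0 < N := by omega
  have hX := QCELS.sampleBound_pos hζ hζ₁ hε (by linarith) hη.le hp hD.le hδ 3
  have hNs : 0 < Ns := Nat.pos_of_ne_zero <| by
    rintro rfl; rw [Nat.cast_zero, mul_zero] at hNNs; linarith [mul_pos hC hX]
  have hfail := hsample hD (QCELS.gapDist_le_eight ⟨_, hlam₀⟩ hII' hI') hp hp₁ hδ hδ₁ hε hε₁ hη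
    hη₁.le hd (hF.filterNorm_pos hlam₀ hq₁) hnorm hN₀ hNs hNNs
  rw [mul_one_div] at hfail
  exact ⟨(sub_le_sub_left hfail 1).trans (hH.one_sub_le_measureReal_successEvent hψ hlam hp hlam₀
      (hII' hlam₀) hF hδ hδ₁ hrel hq' hε hN hNs),
    QCELS.maxTime_timeStep hN₀ ε δ d, QCELS.circuitTime_timeStep_le hε hδ,
    QCELS.sum_circuitTime_le fun i => (QCELS.timeStep_pos hε hδ hN₀ i).le,
    QCELS.le_totalTime_timeStep hε hδ hN d hNNs,
    fun _ => QCELS.totalTime_timeStep_le hε hδ hN₀ d⟩
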